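/- Let $d\ge 1$ and let $\mathcal P\subset\mathbb E^{d+1}$ be a $(d+1)$-polytope (a full-dimensional convex hull of finitely many points) which is regular (its Euclidean symmetry group acts transitively on its flags) and edge-scribed (every edge is tangent, at one of its points, to the unit sphere centred at the origin), with Schläfli symbol $\{p_1,\dots,p_d\}$; that is, $p_k$ is the order of $r_{k-1}r_k$, where, for a flag of $\mathcal P$ and the simplex spanned by the barycenters of its faces of dimensions $0,\dots,d+1$, $r_k$ is the reflection in the wall opposite to the barycenter of the $k$-face. Equip $\mathbb R^{d+2}$ with the Lorentzian product $\langle x,y\rangle=x_1y_1+\cdots+x_{d+1}y_{d+1}-x_{d+2}y_{d+2}$ and put $x_N=e_{d+1}+e_{d+2}$. For $v\in\mathbb E^{d+1}$ with $\|v\|>1$ let $x_v=\frac{1}{\sqrt{\|v\|^2-1}}(v,1)$. The Lorentzian barycenter $x_f$ of a nonempty face $f$ of $\mathcal P$ is the average of $x_v$ over the vertices $v$ of $f$, and its Lorentzian curvature is $\kappa_f=-\langle x_N,x_f\rangle$. Let $(f_0,f_1,\dots,f_d,f_{d+1}=\mathcal P)$ be any flag of $\mathcal P$. For each $2\le i\le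 d+1$ there is a real number $\ell_{\{p_1,\dots,p_{i-1}\}}>0$ which is the half edge-length of every regular edge-scribed $i$-polytope in $\mathbb E^i$ that has Schläfli symbol $\{p_1,\dots,p_{i-1}\}$ or is a realization of $f_i$ (i.e. has face lattice isomorphic to that of $f_i$), and at least one regular edge-scribed $i$-polytope with both properties exists. Put $$L_{\mathcal P}(0)=-1,\qquad L_{\mathcal P}(1)=0,\qquad L_{\mathcal P}(i)=\ell_{\{p_1,\dots,p_{i-1}\}}^{-2}\quad(2\le i\le d+1).$$ Then $L_{\mathcal P}(0)<L_{\mathcal P}(1)<\cdots<L_{\mathcal P}(d+1)$ and $$\kappa_{\mathcal P}^2=L_{\mathcal P}(d+1)\sum_{i=0}^{d}\frac{(\kappa_{f_i}-\kappa_{f_{i+1}})^2}{L_{\mathcal P}(i+1)-L_{\mathcal P}(i)}.$$ -/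

import Mathlib

namespace PolytopalDescartes

noncomputable section

/-- Euclidean space of dimension `n`. -/
abbrev Eucl (n : ℕ) : Type := EuclideanSpace ℝ (Fin n)

/-! ### Lorentzian space -/

/-- Lorentzian space of signature `(d+1, 1)`; the coordinate of index `Fin.last (d+1)` is the
time-like one. -/
abbrev Lor (d : ℕ) : Type := Fin (d + 2) → ℝ

/-- The Lorentzian product `x₁y₁ + ⋯ + x_{d+1}y_{d+1} - x_{d+2}y_{d+2}`. -/
def lorentzProd {d : ℕ} (x y : Lor d) : ℝ :=
  (∑ j : Fin (d + 1), x j.castSucc * y j.castSucc) - x (Fin.last (d + 1)) * y (Fin.last (d + 1))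

/-- The vector `x_N = e_{d+1} + e_{d+2}`. -/
def northVec (d : ℕ) : Lor d :=
  Pi.single (Fin.last d).castSucc 1 + Pi.single (Fin.last (d + 1)) 1

/-- The curvature `κ(x) = -⟨x_N, x⟩` of a vector of Lorentzian space. For the Lorentzian vector of
a ball this is the curvature of the ball. -/
def curv {d : ℕ} (x : Lor d) : ℝ := -lorentzProd (northVec d) x

/-- The Lorentzian vector of the ball whose light source is the outer-sphere point `u` (`‖u‖ > 1`),
that is `(u, 1) / √(‖u‖² - 1)`: the only future-directed vector `x` with `⟨x, x⟩ = 1` on the ray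
of `(u, 1)`. -/
def ballVec {d : ℕ} (u : Eucl (d + 1)) : Lor d :=
  (√(‖u‖ ^ 2 - 1))⁻¹ • (Fin.snoc (α := fun _ => ℝ) (fun j => u j) 1 : Fin (d + 2) → ℝ)

/-! ### Polytopes, faces, flags -/

/-- `P` is an `n`-polytope in `n`-dimensional Euclidean space: the convex hull of finitely many
points, of full dimension. -/
def IsPolytope {n : ℕ} (P : Set (Eucl n)) : Prop :=
  (∃ S : Set (Eucl n), S.Finite ∧ P = convexHull ℝ S) ∧ affineSpan ℝ P = ⊤

/-- `f` is a `k`-face of `P`: a nonempty face (the set of maximizers on `P` of some linear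
functional, so that `P` is a face of itself) of affine dimension `k`. -/
def IsKFace {n : ℕ} (P : Set (Eucl n)) (k : ℕ) (f : Set (Eucl n)) : Prop :=
  IsExposed ℝ P f ∧ f.Nonempty ∧ Module.finrank ℝ (vectorSpan ℝ f) = k

/-- `F 0 ⊂ F 1 ⊂ ⋯ ⊂ F n = P` is a flag of the `n`-polytope `P`. The values `F k` for `k > n` play
no role. -/
def IsFlag {n : ℕ} (P : Set (Eucl n)) (F : ℕ → Set (Eucl n)) : Prop :=
  (∀ k ≤ n, IsKFace P k (F k)) ∧ (∀ k < n, F k ⊆ F (k + 1)) ∧ F n = P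

/-- The `n`-polytope `P` is regular: the Euclidean isometries preserving `P` act transitively on
the flags of `P`. -/
def IsRegular {n : ℕ} (P : Set (Eucl n)) : Prop :=
  ∀ F G : ℕ → Set (Eucl n), IsFlag P F → IsFlag P G →
    ∃ g : Eucl n ≃ᵃⁱ[ℝ] Eucl n, g '' P = P ∧ ∀ k ≤ n, g '' F k = G k

/-- The set `f` is tangent to the unit sphere: its affine span is tangent to the unit sphere at a
point of `f`. -/
def TangentToSphere {n : ℕ} (f : Set (Eucl n)) : Prop :=
  ∃ x ∈ f, ‖x‖ = 1 ∧ ∀ y ∈ affineSpan ℝ f, 1 ≤ ‖y‖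

/-- `P` is edge-scribed: all its edges are tangent to the unit sphere. -/
def IsEdgeScribed {n : ℕ} (P : Set (Eucl n)) : Prop :=
  ∀ e, IsKFace P 1 e → TangentToSphere e

/-- `P` is a regular edge-scribed `n`-polytope in `n`-dimensional Euclidean space. -/
structure IsRegularEdgeScribed {n : ℕ} (P : Set (Eucl n)) : Prop where
  isPolytope : IsPolytope P
  isRegular : IsRegular P
  isEdgeScribed : IsEdgeScribed P

/-- `P` and `Q` are combinatorially equivalent (each is a realization of the other): their face
lattices, which contain the empty face and the whole polytope, are isomorphic. -/
def CombEquiv {m n : ℕ} (P : Set (Eucl m)) (Q : Set (Eucl n)) : Prop :=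
  Nonempty ({f : Set (Eucl m) // IsExposed ℝ P f} ≃o {g : Set (Eucl n) // IsExposed ℝ Q g})

/-- All edges of `P` have length `2 * l`. -/
def HasHalfEdgeLength {n : ℕ} (P : Set (Eucl n)) (l : ℝ) : Prop :=
  ∀ u v : Eucl n, IsKFace P 1 (segment ℝ u v) → dist u v = 2 * l

/-! ### The Schläfli symbol -/

/-- The barycenter of (the vertices of) a polytope. -/
def bary {n : ℕ} (f : Set (Eucl n)) : Eucl n :=
  ((Set.extremePoints ℝ f).ncard : ℝ)⁻¹ • ∑ᶠ v ∈ Set.extremePoints ℝ f, v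

/-- The chamber of a flag `F` is the simplex whose vertices are the barycenters of `F 0, …, F n`.
For `k < n` this is the wall of the chamber opposite to the barycenter of `F k`. -/
def wall {n : ℕ} (F : ℕ → Set (Eucl n)) (k : ℕ) : AffineSubspace ℝ (Eucl n) :=
  affineSpan ℝ (insert (bary (F n)) {x | ∃ j < n, j ≠ k ∧ x = bary (F j)})

instance {n : ℕ} (F : ℕ → Set (Eucl n)) (k : ℕ) : Nonempty (wall F k) :=
  ⟨⟨bary (F n), subset_affineSpan ℝ _ (Set.mem_insert _ _)⟩⟩

/-- The fundamental generator `r_k`: the reflection in the wall opposite to the barycenter of the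
`k`-face of the flag `F`. -/
def fundRefl {n : ℕ} (F : ℕ → Set (Eucl n)) (k : ℕ) : Eucl n ≃ᵃⁱ[ℝ] Eucl n :=
  EuclideanGeometry.reflection (wall F k)

/-- The (regular) `n`-polytope `P` has Schläfli symbol `{p 1, …, p (n-1)}`: the product
`r_{k-1} r_k` of consecutive fundamental generators has order `p k`, for `1 ≤ k ≤ n - 1`. The other
values of `p` play no role. -/
def HasSchlafliSymbol {n : ℕ} (P : Set (Eucl n)) (p : ℕ → ℕ) : Prop :=
  ∀ F : ℕ → Set (Eucl n), IsFlag P F →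
    ∀ k, k + 1 < n → orderOf (fundRefl F k * fundRefl F (k + 1)) = p (k + 1)

/-! ### Lorentzian curvature -/

/-- The Lorentzian barycenter of a polytope `f`: the average of the Lorentzian vectors of the balls
whose light sources are the vertices of `f`. -/
def lorentzBary {d : ℕ} (f : Set (Eucl (d + 1))) : Lor d :=
  ((Set.extremePoints ℝ f).ncard : ℝ)⁻¹ • ∑ᶠ v ∈ Set.extremePoints ℝ f, ballVec v

/-- The Lorentzian curvature of a polytope. -/
def lorentzCurv {d : ℕ} (f : Set (Eucl (d + 1))) : ℝ := curv (lorentzBary f)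

/-- The numbers `L(0) = -1`, `L(1) = 0` and `L(i) = ℓ(i)⁻²` for `i ≥ 2`. -/
def levelL (ℓ : ℕ → ℝ) : ℕ → ℝ
  | 0 => -1
  | 1 => 0
  | i + 2 => (ℓ (i + 2) ^ 2)⁻¹

end

end PolytopalDescartes

open PolytopalDescartes

open PolytopalDescartes

/-! Write b_i for the barycenter of f_i, d_i = b_{i+1} - b_i, l = ‖d_0‖, and e for the last unit
vector of the Euclidean space.

The identity is Parseval's. By regularity all vertices of f_j are equidistant from b_k for each k ≥
j, so b_k - b_j is orthogonal to f_j; hence d_0, …, d_d are pairwise orthogonal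
(`IsRegular.inner_bary_diff`) and nonzero. Edge-scribedness then gives ‖b_1‖ = 1, squared norm 1 +
l² for every vertex (`IsRegularEdgeScribed.norm_vertex_sq`), and center b_{d+1} = 0. So the
curvature of f_i is (1 - ⟨e, b_i⟩) / l, and κ_P = 1 / l. The numbers L are L(i) = (1 - ‖b_i‖²) / l²
(`IsRegularEdgeScribed.levelL_eq`), so by Pythagoras L(i+1) - L(i) = ‖d_i‖² / l² > 0. Each summand
is therefore ⟨d_i, e⟩² / ‖d_i‖²; the sum is ‖e‖² = 1, and L(d+1) = 1 / l² = κ_P².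

What costs work is that L(i) depends only on the symbol or on the face lattice. Existence: the
affine span of f_i cuts the unit sphere in a sphere of center b_i and squared radius 1 - ‖b_i‖²;
rescaling it to a unit sphere turns f_i into a regular edge-scribed i-polytope of half edge-length l
/ √(1 - ‖b_i‖²) (`IsRegularEdgeScribed.exists_realization`).

From lattice to symbol: r_k is the only symmetry moving exactly the k-face of the flag, so words in
the r_k act on flags by successive adjacencies, which an isomorphism of face lattices transports
(`IsRegularEdgeScribed.orderOf_flagMap`).

From symbol to length: consecutive walls of the chamber meet at the angle π / p_k, where p_k is the
order of r_{k-1} r_k (`IsRegularEdgeScribed.sq_stepCovec_eq`). In terms of 1 / ‖d_i‖² this is a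
recurrence that fixes the steps up to a common scale, and ‖b_1‖ = 1 fixes the scale
(`IsRegularEdgeScribed.norm_edge_eq_of_symbol`). -/

namespace PolytopalDescartes

open Set

/-! ### Faces of polytopes: transitivity, strict growth of dimension, intermediate faces. -/

section Polytope

variable {E : Type*} [NormedAddCommGroup E] [NormedSpace ℝ E]

/-- A polytope of any dimension: the convex hull of a finite set. -/
def IsFinHull (P : Set E) : Prop := ∃ S : Set E, S.Finite ∧ P = convexHull ℝ S

namespace IsFinHull

variable {P f g : Set E}

theorem isCompact (hP : IsFinHull P) : IsCompact P := by
  obtain ⟨S, hS, rfl⟩ := hP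
  exact hS.isCompact_convexHull (𝕜 := ℝ)

theorem convex (hP : IsFinHull P) : Convex ℝ P := by
  obtain ⟨S, hS, rfl⟩ := hP
  exact convex_convexHull ℝ S

theorem finite_extremePoints (hP : IsFinHull P) : (P.extremePoints ℝ).Finite := by
  obtain ⟨S, hS, rfl⟩ := hP
  exact hS.subset extremePoints_convexHull_subset

theorem of_finite_extremePoints (hc : IsCompact P) (hP : Convex ℝ P)
    (h : (P.extremePoints ℝ).Finite) : convexHull ℝ (P.extremePoints ℝ) = P := by
  conv_rhs => rw [← closure_convexHull_extremePoints hc hP]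
  exact ((h.isCompact_convexHull (𝕜 := ℝ)).isClosed.closure_eq).symm

theorem convexHull_extremePoints (hP : IsFinHull P) :
    convexHull ℝ (P.extremePoints ℝ) = P :=
  of_finite_extremePoints hP.isCompact hP.convex hP.finite_extremePoints

theorem of_isExposed (hP : IsFinHull P) (hf : IsExposed ℝ P f) : IsFinHull f := by
  have h : (f.extremePoints ℝ).Finite :=
    hP.finite_extremePoints.subset hf.isExtreme.extremePoints_subset_extremePoints
  exact ⟨_, h, (of_finite_extremePoints (hf.isCompact hP.isCompact) (hf.convex hP.convex) h).symm⟩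

theorem subset_of_extremePoints_subset (hP : IsFinHull P) (hf : Convex ℝ f)
    (h : P.extremePoints ℝ ⊆ f) : P ⊆ f := by
  rw [← hP.convexHull_extremePoints]
  exact convexHull_min h hf

theorem extremePoints_nonempty (hP : IsFinHull P) (h : P.Nonempty) :
    (P.extremePoints ℝ).Nonempty :=
  hP.isCompact.extremePoints_nonempty h

theorem toExposed_nonempty (hP : IsFinHull P) (h : P.Nonempty) (l : StrongDual ℝ E) :
    (l.toExposed P).Nonempty := by
  obtain ⟨x, hx, hm⟩ := hP.isCompact.exists_isMaxOn h l.continuous.continuousOn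
  exact ⟨x, hx, fun y hy => hm hy⟩

theorem le_of_extremePoints (hP : IsFinHull P) (l : StrongDual ℝ E) {c : ℝ}
    (h : ∀ v ∈ P.extremePoints ℝ, l v ≤ c) : ∀ x ∈ P, l x ≤ c := by
  have := hP.subset_of_extremePoints_subset (f := {x | l x ≤ c})
    (convex_halfSpace_le l.toLinearMap.isLinear c) h
  exact this

/-- The face of `P` on which a functional is maximal is determined by its values on vertices. -/
theorem toExposed_eq (hP : IsFinHull P) (hf : IsFinHull f) (hfP : f ⊆ P)
    (l : StrongDual ℝ E) {c : ℝ} (hne : f.Nonempty) (h1 : ∀ x ∈ f, l x = c)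
    (h2 : ∀ v ∈ P.extremePoints ℝ, v ∉ f → l v < c) : l.toExposed P = f := by
  have hle : ∀ x ∈ P, l x ≤ c := hP.le_of_extremePoints l fun v hv => by
    by_cases hvf : v ∈ f
    · exact (h1 v hvf).le
    · exact (h2 v hv hvf).le
  obtain ⟨w, hw⟩ := hne
  apply Subset.antisymm
  · have hex : IsExposed ℝ P (l.toExposed P) := ContinuousLinearMap.toExposed.isExposed
    refine (hP.of_isExposed hex).subset_of_extremePoints_subset hf.convex fun v hv => ?_
    by_contra hvf
    have h3 := h2 v (hex.isExtreme.extremePoints_subset_extremePoints hv) hvf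
    have h4 := hv.1.2 w (hfP hw)
    rw [h1 w hw] at h4
    linarith
  · intro x hx
    exact ⟨hfP hx, fun y hy => by rw [h1 x hx]; exact hle y hy⟩

/-- If `l` exposes `f` in `P` and `m` exposes `g` in `f`, then `N • l + m` exposes `g` in `P` for
large `N`, since only finitely many vertices constrain `N`. For general convex sets this fails. -/
theorem isExposed_trans (hP : IsFinHull P) (hf : IsExposed ℝ P f) (hg : IsExposed ℝ f g) :
    IsExposed ℝ P g := by
  intro hne
  obtain ⟨w, hw⟩ := hne
  have hgf := hg.subset
  obtain ⟨l, hl⟩ := hf ⟨w, hgf hw⟩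
  obtain ⟨m, hm⟩ := hg ⟨w, hw⟩
  have hwP := hf.subset (hgf hw)
  have hlw : ∀ x ∈ f, l x = l w := fun x hx => by
    have hx' := hx
    have hw' := hgf hw
    rw [hl] at hx' hw'
    exact le_antisymm (hw'.2 x hx'.1) (hx'.2 w hw'.1)
  have hlt : ∀ x ∈ P, x ∉ f → l x < l w := fun x hx hxf => by
    have hw' := hgf hw
    rw [hl] at hw'
    refine lt_of_le_of_ne (hw'.2 x hx) fun he => hxf ?_
    rw [hl]
    exact ⟨hx, fun y hy => he ▸ hw'.2 y hy⟩
  have hmw : ∀ x ∈ g, m x = m w := fun x hx => by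
    have hx' := hx
    have hw' := hw
    rw [hm] at hx' hw'
    exact le_antisymm (hw'.2 x hx'.1) (hx'.2 w hw'.1)
  have hmlt : ∀ x ∈ f, x ∉ g → m x < m w := fun x hx hxf => by
    have hw' := hw
    rw [hm] at hw'
    refine lt_of_le_of_ne (hw'.2 x hx) fun he => hxf ?_
    rw [hm]
    exact ⟨hx, fun y hy => he ▸ hw'.2 y hy⟩
  have hN : ∀ᶠ N : ℝ in Filter.atTop, ∀ v ∈ P.extremePoints ℝ, v ∉ f →
      m v - m w < N * (l w - l v) := by
    rw [Filter.eventually_all_finite hP.finite_extremePoints]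
    intro v hv
    by_cases hvf : v ∈ f
    · exact Filter.Eventually.of_forall fun _ h => absurd hvf h
    · have h0 : 0 < l w - l v := sub_pos.2 (hlt v hv.1 hvf)
      filter_upwards [(Filter.tendsto_id.atTop_mul_const h0).eventually_gt_atTop (m v - m w)]
        with N hN _ using hN
  obtain ⟨N, hN⟩ := hN.exists
  refine ⟨N • l + m, ?_⟩
  refine (toExposed_eq hP ((hP.of_isExposed hf).of_isExposed hg) (hgf.trans hf.subset)
    (N • l + m) (c := N * l w + m w) ⟨w, hw⟩ ?_ ?_).symm
  · intro x hx
    simp [hlw x (hgf hx), hmw x hx]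
  · intro v hv hvg
    simp only [add_apply, smul_apply, smul_eq_mul]
    by_cases hvf : v ∈ f
    · rw [hlw v hvf]
      linarith [hmlt v hvf hvg]
    · linarith [hN v hv hvf]

theorem isExposed_singleton (hP : IsFinHull P) {v : E} (hv : v ∈ P.extremePoints ℝ) :
    IsExposed ℝ P {v} := by
  intro _
  have hS : (P.extremePoints ℝ \ {v}).Finite := hP.finite_extremePoints.sdiff
  have hvn : v ∉ convexHull ℝ (P.extremePoints ℝ \ {v}) := by
    have h := (hP.convex.mem_extremePoints_iff_mem_sdiff_convexHull_sdiff.1 hv).2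
    exact fun h' => h (convexHull_mono (sdiff_subset_sdiff_left extremePoints_subset) h')
  obtain ⟨l, u, hl, hu⟩ := geometric_hahn_banach_closed_point (convex_convexHull ℝ _)
    (hS.isCompact_convexHull (𝕜 := ℝ)).isClosed hvn
  refine ⟨l, (toExposed_eq hP ⟨{v}, finite_singleton v, by simp⟩ (by simpa using hv.1) l (c := l v)
    (singleton_nonempty v) (by simp) ?_).symm⟩
  intro w hw hwv
  exact (hl w (subset_convexHull ℝ _ ⟨hw, hwv⟩)).trans hu

end IsFinHull

/-- The exposing functional vanishes on the directions of `f`; if these were all the directions of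
`P`, it would be constant on `P`, and `f` would be `P`. -/
theorem finrank_lt_of_isExposed [FiniteDimensional ℝ E] {P f : Set E} (hf : IsExposed ℝ P f)
    (hne : f.Nonempty) (h : f ≠ P) :
    Module.finrank ℝ (vectorSpan ℝ f) < Module.finrank ℝ (vectorSpan ℝ P) := by
  apply Submodule.finrank_lt_finrank_of_lt
  refine lt_of_le_of_ne (vectorSpan_mono ℝ hf.subset) fun he => ?_
  obtain ⟨w, hw⟩ := hne
  obtain ⟨l, hl⟩ := hf ⟨w, hw⟩
  have hw' := hw
  rw [hl] at hw'
  have hk : vectorSpan ℝ f ≤ LinearMap.ker l.toLinearMap := by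
    rw [vectorSpan_def, Submodule.span_le]
    rintro _ ⟨x, hx, y, hy, rfl⟩
    rw [hl] at hx hy
    have := hx.2 y hy.1
    have := hy.2 x hx.1
    simp only [SetLike.mem_coe, LinearMap.mem_ker, ContinuousLinearMap.coe_coe, vsub_eq_sub, map_sub]
    linarith
  apply h
  refine hf.subset.antisymm fun x hx => ?_
  have hxw : x -ᵥ w ∈ vectorSpan ℝ f := he ▸ vsub_mem_vectorSpan ℝ hx hw'.1
  have := hk hxw
  simp only [LinearMap.mem_ker, ContinuousLinearMap.coe_coe, vsub_eq_sub, map_sub] at this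
  rw [hl]
  refine ⟨hx, fun y hy => ?_⟩
  have := hw'.2 y hy
  linarith

/-- Rotating a supporting hyperplane of a face about an affine subspace containing the face, until
it meets a further vertex. -/
theorem IsFinHull.exists_rotation {g f : Set E} (hg : IsFinHull g) {l m : StrongDual ℝ E}
    (hl : f = l.toExposed g) (hne : f.Nonempty) (hfg : f ≠ g) (hm : ∀ x ∈ f, ∀ y ∈ f, m x = m y) :
    ∃ t : ℝ, f ⊆ (m + t • l).toExposed g ∧ f ≠ (m + t • l).toExposed g := by
  obtain ⟨w, hw⟩ := hne
  have hfe : IsExposed ℝ g f := hl ▸ ContinuousLinearMap.toExposed.isExposed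
  have hw' := hw
  rw [hl] at hw'
  have hlw : ∀ x ∈ f, l x = l w := fun x hx => by
    rw [hl] at hx
    exact le_antisymm (hw'.2 x hx.1) (hx.2 w hw'.1)
  have hlt : ∀ x ∈ g, x ∉ f → l x < l w := fun x hx hxf => by
    refine lt_of_le_of_ne (hw'.2 x hx) fun he => hxf ?_
    rw [hl]
    exact ⟨hx, fun y hy => he ▸ hw'.2 y hy⟩
  have hfin : (g.extremePoints ℝ \ f).Finite := hg.finite_extremePoints.sdiff
  have hnv : (g.extremePoints ℝ \ f).Nonempty := by
    by_contra h
    rw [not_nonempty_iff_eq_empty, sdiff_eq_empty] at h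
    exact hfg (hfe.subset.antisymm
      (hg.subset_of_extremePoints_subset (hfe.convex hg.convex) h))
  -- The largest slope over the vertices outside `f` is the least `t` for which `m + t • l` is still
  -- maximal on `f`; the vertex `s` attaining it joins the new face.
  obtain ⟨s, hs, hmax⟩ := hfin.exists_maximalFor (fun s => (m s - m w) / (l w - l s)) _ hnv
  have hmax' : ∀ v ∈ g.extremePoints ℝ \ f,
      (m v - m w) / (l w - l v) ≤ (m s - m w) / (l w - l s) := fun v hv => by
    rcases le_total ((m v - m w) / (l w - l v)) ((m s - m w) / (l w - l s)) with h | h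
    · exact h
    · exact hmax hv h
  set t := (m s - m w) / (l w - l s) with ht
  have hle : ∀ x ∈ g, (m + t • l) x ≤ (m + t • l) w := by
    apply hg.le_of_extremePoints
    intro v hv
    simp only [add_apply, smul_apply, smul_eq_mul]
    by_cases hvf : v ∈ f
    · rw [hlw v hvf, hm v hvf w hw]
    · have h1 := hmax' v ⟨hv, hvf⟩
      rw [div_le_iff₀ (sub_pos.2 (hlt v hv.1 hvf))] at h1
      linarith
  have hsw : (m + t • l) s = (m + t • l) w := by
    have h0 := sub_pos.2 (hlt s hs.1.1 hs.2)
    have : t * (l w - l s) = m s - m w := div_mul_cancel₀ _ h0.ne'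
    simp only [add_apply, smul_apply, smul_eq_mul]
    linarith
  refine ⟨t, fun x hx => ⟨hfe.subset hx, fun y hy => ?_⟩, fun he => hs.2 ?_⟩
  · have : (m + t • l) x = (m + t • l) w := by
      simp [hlw x hx, hm x hx w hw]
    rw [this]
    exact hle y hy
  · rw [he]
    exact ⟨hs.1.1, fun y hy => hsw ▸ hle y hy⟩

/-- If `f` is a face of `g` of codimension at least `2`, there are two distinct faces strictly
between `f` and `g`. -/
theorem IsFinHull.exists_two_between [FiniteDimensional ℝ E] {g f : Set E} (hg : IsFinHull g)
    (hf : IsExposed ℝ g f) (hne : f.Nonempty)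
    (hd : Module.finrank ℝ (vectorSpan ℝ f) + 2 ≤ Module.finrank ℝ (vectorSpan ℝ g)) :
    ∃ h h' : Set E, h ≠ h' ∧ (IsExposed ℝ g h ∧ f ⊆ h ∧ f ≠ h ∧ h ≠ g) ∧
      (IsExposed ℝ g h' ∧ f ⊆ h' ∧ f ≠ h' ∧ h' ≠ g) := by
  obtain ⟨w, hw⟩ := hne
  have hfg : f ≠ g := by rintro rfl; omega
  obtain ⟨l, hl⟩ := hf ⟨w, hw⟩
  have hlf : f = l.toExposed g := hl
  have hw' := hw
  rw [hl] at hw'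
  have hwg := hf.subset hw
  -- a direction transverse to `f` on which `l` vanishes
  obtain ⟨x, hx, hxf⟩ : ∃ x ∈ vectorSpan ℝ g ⊓ LinearMap.ker l.toLinearMap, x ∉ vectorSpan ℝ f := by
    by_contra! h
    have h1 := Submodule.finrank_mono (R := ℝ) (s := vectorSpan ℝ g ⊓ LinearMap.ker l.toLinearMap)
      (t := vectorSpan ℝ f) h
    have h2 := Submodule.finrank_sup_add_finrank_inf_eq (vectorSpan ℝ g)
      (LinearMap.ker l.toLinearMap)
    have h3 := LinearMap.finrank_range_add_finrank_ker l.toLinearMap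
    have h4 : Module.finrank ℝ (LinearMap.range l.toLinearMap) ≤ 1 := by
      simpa using Submodule.finrank_le (LinearMap.range l.toLinearMap)
    have h5 := Submodule.finrank_le (vectorSpan ℝ g ⊔ LinearMap.ker l.toLinearMap)
    omega
  obtain ⟨m₀, hmx, hm0⟩ := Submodule.exists_le_ker_of_notMem hxf
  set m : StrongDual ℝ E := LinearMap.toContinuousLinearMap m₀ with hmdef
  have hmx' : m x ≠ 0 := hmx
  have hlx : l x = 0 := hx.2
  have hmf : ∀ x ∈ f, ∀ y ∈ f, m x = m y := fun x hx y hy => by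
    have : m (x - y) = 0 := hm0 (vsub_mem_vectorSpan ℝ hx hy)
    rwa [map_sub, sub_eq_zero] at this
  -- a functional which is constant on `g` vanishes on `x`
  have hconst : ∀ k : StrongDual ℝ E, (∀ y ∈ g, k y = k w) → k x = 0 := fun k hk => by
    have : vectorSpan ℝ g ≤ LinearMap.ker k.toLinearMap := by
      rw [vectorSpan_def, Submodule.span_le]
      rintro _ ⟨y, hy, z, hz, rfl⟩
      simp [hk y hy, hk z hz]
    exact this hx.1
  -- The two faces come from rotating in the opposite directions `m` and `-m`. If they coincided,
  -- then `t' = -t`, and `m + t • l` would be constant on `g`. That is impossible, because along `x`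
  -- the functional `l` vanishes and `m` does not.
  obtain ⟨t, ht1, ht2⟩ := hg.exists_rotation hlf ⟨w, hw⟩ hfg hmf
  obtain ⟨t', ht1', ht2'⟩ := hg.exists_rotation (m := -m) hlf ⟨w, hw⟩ hfg
    (fun x hx y hy => by simp [hmf x hx y hy])
  have hw1 := ht1 hw
  have hw2 := ht1' hw
  refine ⟨_, _, ?_, ⟨ContinuousLinearMap.toExposed.isExposed, ht1, ht2, ?_⟩,
    ⟨ContinuousLinearMap.toExposed.isExposed, ht1', ht2', ?_⟩⟩
  · intro he
    obtain ⟨y, hy, hyf⟩ := exists_of_ssubset (ht1.ssubset_of_ne ht2)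
    have hy' := hy
    rw [he] at hy'
    have hyl : l y < l w := by
      refine lt_of_le_of_ne (hw'.2 y hy.1) fun h => hyf ?_
      rw [hl]
      exact ⟨hy.1, fun z hz => h ▸ hw'.2 z hz⟩
    have e1 := le_antisymm (hw1.2 y hy.1) (hy.2 w hwg)
    have e2 := le_antisymm (hw2.2 y hy.1) (hy'.2 w hwg)
    simp only [add_apply, smul_apply, smul_eq_mul, neg_apply] at e1 e2
    have htt : t' = -t := by
      have : (t + t') * (l w - l y) = 0 := by linarith
      rcases mul_eq_zero.1 this with h | h <;> linarith
    have h3 := hconst (m + t • l) fun z hz => le_antisymm (hw1.2 z hz) (by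
      have := hw2.2 z hz
      simp only [add_apply, smul_apply, smul_eq_mul, neg_apply, htt] at this ⊢
      linarith)
    simp [hlx] at h3
    exact hmx' h3
  · intro he
    have h3 := hconst (m + t • l) fun z hz => le_antisymm (hw1.2 z hz) (by
      rw [← he] at hz
      exact hz.2 w hwg)
    simp [hlx] at h3
    exact hmx' h3
  · intro he
    have h3 := hconst (-m + t' • l) fun z hz => le_antisymm (hw2.2 z hz) (by
      rw [← he] at hz
      exact hz.2 w hwg)
    simp [hlx] at h3
    exact hmx' h3

/-- A polytope which is not a point has two disjoint nonempty proper faces. -/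
theorem IsFinHull.exists_two_faces [FiniteDimensional ℝ E] {g : Set E} (hg : IsFinHull g)
    (hne : g.Nonempty) (hd : 0 < Module.finrank ℝ (vectorSpan ℝ g)) :
    ∃ h h' : Set E, h ≠ h' ∧ (IsExposed ℝ g h ∧ h.Nonempty ∧ h ≠ g) ∧
      (IsExposed ℝ g h' ∧ h'.Nonempty ∧ h' ≠ g) := by
  obtain ⟨w, hw⟩ := hne
  obtain ⟨x, hx, hx0⟩ := Submodule.exists_mem_ne_zero_of_ne_bot
    (Submodule.one_le_finrank_iff.1 hd)
  obtain ⟨m₀, hmx, -⟩ := Submodule.exists_le_ker_of_notMem (p := (⊥ : Submodule ℝ E)) (v := x)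
    (by simpa using hx0)
  set m : StrongDual ℝ E := LinearMap.toContinuousLinearMap m₀ with hmdef
  have hmx' : m x ≠ 0 := hmx
  have hconst : ¬ ∀ y ∈ g, m y = m w := fun hk => by
    have : vectorSpan ℝ g ≤ LinearMap.ker m.toLinearMap := by
      rw [vectorSpan_def, Submodule.span_le]
      rintro _ ⟨y, hy, z, hz, rfl⟩
      simp [hk y hy, hk z hz]
    exact hmx' (this hx)
  obtain ⟨a, ha⟩ := hg.toExposed_nonempty ⟨w, hw⟩ m
  obtain ⟨b, hb⟩ := hg.toExposed_nonempty ⟨w, hw⟩ (-m)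
  have hb' : ∀ y ∈ g, m b ≤ m y := fun y hy => by simpa using hb.2 y hy
  have hab : m b < m a := by
    refine lt_of_le_of_ne (ha.2 b hb.1) fun he => hconst fun y hy => ?_
    have h1 := ha.2 y hy
    have h2 := ha.2 w hw
    have h3 := hb' y hy
    have h4 := hb' w hw
    linarith
  refine ⟨_, _, ?_, ⟨ContinuousLinearMap.toExposed.isExposed, ⟨a, ha⟩, ?_⟩,
    ⟨ContinuousLinearMap.toExposed.isExposed, ⟨b, hb⟩, ?_⟩⟩
  · intro he
    have hb2 := hb
    rw [← he] at hb2
    have := hb2.2 a ha.1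
    linarith
  · intro he
    have hb2 := hb.1
    rw [← he] at hb2
    have := hb2.2 a ha.1
    linarith
  · intro he
    have ha2 := ha.1
    rw [← he] at ha2
    have : -m b ≤ - m a := ha2.2 b hb.1
    linarith

end Polytope

/-! ### Faces by dimension, chains of faces, flags and adjacent flags. -/

section Flags

variable {n : ℕ} {P f g : Set (Eucl n)} {j k m : ℕ} {F : ℕ → Set (Eucl n)}

theorem IsPolytope.isFinHull (hP : IsPolytope P) : IsFinHull P := hP.1

namespace IsKFace

theorem subset (hf : IsKFace P k f) : f ⊆ P := hf.1.subset

theorem isFinHull (hP : IsFinHull P) (hf : IsKFace P k f) : IsFinHull f := hP.of_isExposed hf.1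

theorem of_subset (hf : IsKFace P k f) (hg : g ⊆ P) (hfg : f ⊆ g) : IsKFace g k f :=
  ⟨hf.1.mono hg hfg, hf.2⟩

theorem trans (hP : IsFinHull P) (hg : IsKFace P m g) (hf : IsKFace g k f) : IsKFace P k f :=
  ⟨hP.isExposed_trans hg.1 hf.1, hf.2⟩

theorem lt_of_ne (hf : IsKFace P j f) (hg : IsKFace P k g) (h : f ⊆ g) (hne : f ≠ g) : j < k := by
  rw [← hf.2.2, ← hg.2.2]
  exact finrank_lt_of_isExposed (hf.1.mono hg.subset h) hf.2.1 hne

theorem le_of_subset (hf : IsKFace P j f) (hg : IsKFace P k g) (h : f ⊆ g) : j ≤ k := by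
  by_cases hne : f = g
  · rw [← hf.2.2, ← hg.2.2, hne]
  · exact (hf.lt_of_ne hg h hne).le

theorem eq_of_subset (hf : IsKFace P k f) (hg : IsKFace P k g) (h : f ⊆ g) : f = g := by
  by_contra hne
  exact (hf.lt_of_ne hg h hne).ne rfl

theorem singleton (hP : IsFinHull P) {v : Eucl n} (hv : v ∈ P.extremePoints ℝ) :
    IsKFace P 0 {v} :=
  ⟨hP.isExposed_singleton hv, singleton_nonempty v, by simp⟩

theorem eq_singleton (hf : IsKFace P 0 f) : ∃ v ∈ P.extremePoints ℝ, f = {v} := by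
  obtain ⟨v, hv⟩ := hf.2.1
  have h := hf.2.2
  rw [Submodule.finrank_eq_zero, vectorSpan_eq_bot_iff_subsingleton] at h
  have hfv : f = {v} := h.eq_singleton_of_mem hv
  refine ⟨v, ?_, hfv⟩
  rw [← isExtreme_singleton, ← hfv]
  exact hf.1.isExtreme

end IsKFace

theorem IsPolytope.isKFace_self (hP : IsPolytope P) : IsKFace P n P := by
  refine ⟨IsExposed.refl P, ?_, ?_⟩
  · rw [← affineSpan_nonempty ℝ, hP.2]
    exact ⟨0, trivial⟩
  · rw [← direction_affineSpan, hP.2, AffineSubspace.direction_top]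
    simp

/-- A chain of faces of consecutive dimensions `j, …, m`. -/
def IsFaceChain (P : Set (Eucl n)) (j m : ℕ) (G : ℕ → Set (Eucl n)) : Prop :=
  (∀ k, j ≤ k → k ≤ m → IsKFace P k (G k)) ∧ ∀ k, j ≤ k → k < m → G k ⊆ G (k + 1)

theorem isFlag_iff : IsFlag P F ↔ IsFaceChain P 0 n F ∧ F n = P := by
  simp [IsFlag, IsFaceChain, and_assoc]

theorem IsFaceChain.glue {a : ℕ} {G H : ℕ → Set (Eucl n)} (hG : IsFaceChain P j a G)
    (hH : IsFaceChain P a m H) (h : G a = H a) :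
    IsFaceChain P j m (fun k => if k ≤ a then G k else H k) := by
  refine ⟨fun k h1 h2 => ?_, fun k h1 h2 => ?_⟩
  · dsimp only
    split_ifs with hk
    · exact hG.1 k h1 hk
    · exact hH.1 k (by omega) h2
  · dsimp only
    rcases lt_trichotomy k a with hk | rfl | hk
    · rw [if_pos hk.le, if_pos (Nat.succ_le_of_lt hk)]
      exact hG.2 k h1 hk
    · rw [if_pos le_rfl, if_neg (by omega), h]
      exact hH.2 k le_rfl h2
    · rw [if_neg (by omega), if_neg (by omega)]
      exact hH.2 k hk.le h2

/-- Induction on the gap in dimension: an intermediate face splits the problem into two smaller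
ones, whose chains are glued. -/
theorem IsFinHull.exists_faceChain (hP : IsFinHull P) (hf : IsKFace P j f) (hg : IsKFace P m g)
    (hfg : f ⊆ g) : ∃ G, G j = f ∧ G m = g ∧ IsFaceChain P j m G := by
  induction hd : m - j using Nat.strong_induction_on generalizing j m f g with
  | _ d ih =>
    have hjm := hf.le_of_subset hg hfg
    rcases Nat.lt_or_ge m (j + 2) with h2 | h2
    · obtain rfl | rfl : m = j ∨ m = j + 1 := by omega
      · obtain rfl := hf.eq_of_subset hg hfg
        exact ⟨fun _ => f, rfl, rfl, fun k h1 h2 => by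
          obtain rfl : k = m := by omega
          exact hf, fun k h1 h2 => by omega⟩
      · refine ⟨fun k => if k = j then f else g, if_pos rfl, if_neg (by omega), ?_, ?_⟩
        · intro k h1 h3
          obtain rfl | rfl : k = j ∨ k = j + 1 := by omega
          · simpa using hf
          · simpa using hg
        · intro k h1 h3
          obtain rfl : k = j := by omega
          simpa using hfg
    · obtain ⟨h, -, -, ⟨he, hfh, hnf, hng⟩, -⟩ := (hg.isFinHull hP).exists_two_between
        (hf.of_subset hg.subset hfg).1 hf.2.1 (by rw [hf.2.2, hg.2.2]; exact h2)
      have hh : IsKFace P (Module.finrank ℝ (vectorSpan ℝ h)) h :=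
        hg.trans hP ⟨he, hf.2.1.mono hfh, rfl⟩
      have h3 := hf.lt_of_ne hh hfh hnf
      have h4 := hh.lt_of_ne hg he.subset hng
      obtain ⟨G, hG1, hG2, hG⟩ := ih _ (by omega) hf hh hfh rfl
      obtain ⟨H, hH1, hH2, hH⟩ := ih _ (by omega) hh hg he.subset rfl
      refine ⟨_, ?_, ?_, hG.glue hH (hG2.trans hH1.symm)⟩
      · rw [if_pos h3.le, hG1]
      · rw [if_neg (by omega), hH2]

theorem IsFlag.isKFace (hF : IsFlag P F) (hk : k ≤ n) : IsKFace P k (F k) := hF.1 k hk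

theorem IsFlag.mono (hF : IsFlag P F) (hjk : j ≤ k) (hk : k ≤ n) : F j ⊆ F k := by
  induction k, hjk using Nat.le_induction with
  | base => rfl
  | succ k h ih => exact (ih (by omega)).trans (hF.2.1 k (by omega))

theorem IsFlag.isFinHull (hP : IsFinHull P) (hF : IsFlag P F) (hk : k ≤ n) : IsFinHull (F k) :=
  (hF.isKFace hk).isFinHull hP

theorem IsFlag.nonempty (hF : IsFlag P F) (hk : k ≤ n) : (F k).Nonempty := (hF.isKFace hk).2.1

/-- The lower part of a flag may be replaced by a chain starting at any vertex. -/
theorem IsFlag.exists_flag_of_vertex (hP : IsFinHull P) (hF : IsFlag P F) (hk : k ≤ n)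
    {v : Eucl n} (hv : v ∈ (F k).extremePoints ℝ) :
    ∃ G, IsFlag P G ∧ G 0 = {v} ∧ ∀ i, k ≤ i → G i = F i := by
  have hv' : v ∈ P.extremePoints ℝ :=
    (hF.isKFace hk).1.isExtreme.extremePoints_subset_extremePoints hv
  obtain ⟨G, h0, h1, hG⟩ := hP.exists_faceChain (IsKFace.singleton hP hv') (hF.isKFace hk)
    (by simpa using hv.1)
  have hFc : IsFaceChain P k n F :=
    ⟨fun i _ hi => hF.isKFace hi, fun i _ hi => hF.2.1 i hi⟩
  refine ⟨_, isFlag_iff.2 ⟨hG.glue hFc h1, ?_⟩, ?_, ?_⟩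
  · split_ifs with h
    · obtain rfl : n = k := by omega
      rw [h1, hF.2.2]
    · exact hF.2.2
  · simp [h0]
  · intro i hi
    split_ifs with h
    · obtain rfl : i = k := by omega
      exact h1
    · rfl

theorem IsPolytope.exists_flag_of_face (hP : IsPolytope P) (hf : IsKFace P k f) :
    ∃ F, IsFlag P F ∧ F k = f := by
  obtain ⟨v, hv⟩ := (hf.isFinHull hP.isFinHull).extremePoints_nonempty hf.2.1
  have hv' : v ∈ P.extremePoints ℝ := hf.1.isExtreme.extremePoints_subset_extremePoints hv
  obtain ⟨G, h0, h1, hG⟩ := hP.isFinHull.exists_faceChain (IsKFace.singleton hP.isFinHull hv') hf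
    (by simpa using hv.1)
  obtain ⟨H, h2, h3, hH⟩ := hP.isFinHull.exists_faceChain hf hP.isKFace_self hf.subset
  refine ⟨_, isFlag_iff.2 ⟨hG.glue hH (h1.trans h2.symm), ?_⟩, ?_⟩
  · split_ifs with h
    · obtain rfl : n = k := le_antisymm h (hf.le_of_subset hP.isKFace_self hf.subset)
      rw [h1, ← h2, h3]
    · exact h3
  · simp [h1]

theorem IsPolytope.exists_flag (hP : IsPolytope P) : ∃ F, IsFlag P F := by
  obtain ⟨F, hF, -⟩ := hP.exists_flag_of_face hP.isKFace_self
  exact ⟨F, hF⟩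

/-- Flags differing in their `k`-face only. -/
def FlagAdj (k : ℕ) (F G : ℕ → Set (Eucl n)) : Prop :=
  (∀ j ≤ n, j ≠ k → G j = F j) ∧ G k ≠ F k

/-- Two distinct faces lie strictly between the neighbours of `F k`, so at least one of them is not
`F k`. For `k = 0` the lower neighbour would be the empty face, which is treated apart. -/
theorem IsFlag.exists_flagAdj (hP : IsFinHull P) (hF : IsFlag P F) (hk : k < n) :
    ∃ G, IsFlag P G ∧ FlagAdj k F G := by
  classical
  have hup := hF.isKFace (Nat.succ_le_of_lt hk)
  suffices h : ∃ h, IsKFace P k h ∧ h ≠ F k ∧ h ⊆ F (k + 1) ∧ ∀ j, j + 1 = k → F j ⊆ h by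
    obtain ⟨h, hh, hne, hhu, hhl⟩ := h
    refine ⟨Function.update F k h, ⟨fun j hj => ?_, fun j hj => ?_, ?_⟩, fun j hj hjk => ?_, ?_⟩
    · by_cases hjk : j = k
      · subst hjk
        simpa using hh
      · simpa [hjk] using hF.isKFace hj
    · by_cases hjk : j = k
      · subst hjk
        simpa using hhu
      · by_cases hjk' : j + 1 = k
        · rw [Function.update_of_ne hjk, hjk', Function.update_self]
          exact hhl j hjk'
        · rw [Function.update_of_ne hjk, Function.update_of_ne hjk']
          exact hF.2.1 j hj
    · rw [Function.update_of_ne hk.ne', hF.2.2]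
    · rw [Function.update_of_ne hjk]
    · simpa using hne
  cases k with
  | zero =>
    obtain ⟨h, h', hne, ⟨h1, h2, h3⟩, ⟨h1', h2', h3'⟩⟩ := (hup.isFinHull hP).exists_two_faces hup.2.1
      (by rw [hup.2.2]; omega)
    have key : ∀ h, IsExposed ℝ (F (0 + 1)) h → h.Nonempty → h ≠ F (0 + 1) → IsKFace P 0 h := by
      intro h h1 h2 h3
      have h4 : IsKFace P _ h := hup.trans hP ⟨h1, h2, rfl⟩
      have h5 := h4.lt_of_ne hup h1.subset h3
      have : Module.finrank ℝ (vectorSpan ℝ h) = 0 := by omega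
      rwa [this] at h4
    by_cases he : h = F 0
    · exact ⟨h', key _ h1' h2' h3', fun he' => hne (he.trans he'.symm), h1'.subset,
        fun j hj => by omega⟩
    · exact ⟨h, key _ h1 h2 h3, he, h1.subset, fun j hj => by omega⟩
  | succ k =>
    have hlo := hF.isKFace (k := k) (by omega)
    have hlu : F k ⊆ F (k + 1 + 1) := hF.mono (by omega) (by omega)
    obtain ⟨h, h', hne, ⟨h1, h2, h3, h4⟩, ⟨h1', h2', h3', h4'⟩⟩ :=
      (hup.isFinHull hP).exists_two_between
        (hlo.of_subset hup.subset hlu).1 hlo.2.1 (by rw [hlo.2.2, hup.2.2])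
    have key : ∀ h, IsExposed ℝ (F (k + 1 + 1)) h → F k ⊆ h → F k ≠ h → h ≠ F (k + 1 + 1) →
        IsKFace P (k + 1) h := by
      intro h h1 h2 h3 h4
      have h5 : IsKFace P _ h := hup.trans hP ⟨h1, hlo.2.1.mono h2, rfl⟩
      have h6 := h5.lt_of_ne hup h1.subset h4
      have h7 := hlo.lt_of_ne h5 h2 h3
      have : Module.finrank ℝ (vectorSpan ℝ h) = k + 1 := by omega
      rwa [this] at h5
    by_cases he : h = F (k + 1)
    · refine ⟨h', key _ h1' h2' h3' h4', fun he' => hne (he.trans he'.symm), h1'.subset,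
        fun j hj => ?_⟩
      obtain rfl : j = k := by omega
      exact h2'
    · refine ⟨h, key _ h1 h2 h3 h4, he, h1.subset, fun j hj => ?_⟩
      obtain rfl : j = k := by omega
      exact h2

end Flags

/-! ### Barycenters detect inclusion in faces. -/

section Barycenter

variable {n : ℕ} {P f h : Set (Eucl n)}

theorem IsFinHull.bary_eq_sum (hf : IsFinHull f) :
    bary f = ((hf.finite_extremePoints.toFinset.card : ℝ))⁻¹ •
      ∑ v ∈ hf.finite_extremePoints.toFinset, v := by
  rw [bary, Set.ncard_eq_toFinset_card _ hf.finite_extremePoints,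
    finsum_mem_eq_finite_toFinset_sum _ hf.finite_extremePoints]

theorem IsFinHull.card_extremePoints_pos (hf : IsFinHull f) (hne : f.Nonempty) :
    0 < (hf.finite_extremePoints.toFinset.card : ℝ) := by
  rw [Nat.cast_pos, Finset.card_pos]
  simpa using hf.extremePoints_nonempty hne

theorem IsFinHull.bary_mem (hf : IsFinHull f) (hne : f.Nonempty) : bary f ∈ f := by
  rw [hf.bary_eq_sum, Finset.smul_sum]
  have hc := hf.card_extremePoints_pos hne
  refine hf.convex.sum_mem (fun _ _ => by positivity) ?_ fun v hv => ?_
  · rw [Finset.sum_const, nsmul_eq_mul, mul_inv_cancel₀ hc.ne']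
  · exact extremePoints_subset (by simpa using hv)

/-- A face containing the barycenter of a subpolytope contains it. -/
theorem IsFinHull.subset_of_bary_mem (hf : IsFinHull f) (hne : f.Nonempty) (hP : IsFinHull P)
    (hfP : f ⊆ P) (hh : IsExposed ℝ P h) (hb : bary f ∈ h) : f ⊆ h := by
  obtain ⟨l, hl⟩ := hh ⟨_, hb⟩
  refine hf.subset_of_extremePoints_subset (hh.convex hP.convex) fun v hv => ?_
  have hb' := hb
  rw [hl] at hb' ⊢
  have hc := hf.card_extremePoints_pos hne
  have hle : ∀ w ∈ hf.finite_extremePoints.toFinset, l w ≤ l (bary f) := fun w hw =>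
    hb'.2 w (hfP (extremePoints_subset (by simpa using hw)))
  -- The average of `l` over the vertices equals its maximum, so every vertex attains the maximum.
  have hsum : ∑ w ∈ hf.finite_extremePoints.toFinset, l w =
      ∑ w ∈ hf.finite_extremePoints.toFinset, l (bary f) := by
    rw [Finset.sum_const, nsmul_eq_mul]
    conv_rhs => rw [hf.bary_eq_sum]
    rw [map_smul, map_sum, smul_eq_mul, mul_inv_cancel_left₀ hc.ne']
  have := (Finset.sum_eq_sum_iff_of_le hle).1 hsum v (by simpa using hv)
  exact ⟨hfP hv.1, fun y hy => this ▸ hb'.2 y hy⟩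

end Barycenter

/-! ### Invariance of faces, dimensions and barycenters under injective affine maps. -/

section AffineImage

variable {m n : ℕ} {P f : Set (Eucl m)} {k : ℕ} (φ : Eucl m →ᵃ[ℝ] Eucl n)

theorem isExposed_image (hφ : Function.Injective φ) :
    IsExposed ℝ (φ '' P) (φ '' f) ↔ IsExposed ℝ P f := by
  have hlin : Function.Injective φ.linear := φ.linear_injective_iff.2 hφ
  constructor
  · rintro h ⟨w, hw⟩
    obtain ⟨l, hl⟩ := h ⟨_, mem_image_of_mem φ hw⟩
    have hs : ∀ x y, l (φ x) ≤ l (φ y) ↔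
        (l.comp φ.linear.toContinuousLinearMap) x ≤ (l.comp φ.linear.toContinuousLinearMap) y := by
      intro x y
      have e : ∀ x, φ x = φ.linear x + φ 0 := fun x => congrFun φ.decomp x
      simp [e x, e y]
    refine ⟨l.comp φ.linear.toContinuousLinearMap, ?_⟩
    ext x
    rw [← hφ.mem_set_image, hl]
    simp only [mem_ofPred_eq, hφ.mem_set_image, forall_mem_image, hs]
  · rintro h ⟨_, w, hw, rfl⟩
    obtain ⟨l, hl⟩ := h ⟨w, hw⟩
    obtain ⟨r, hr⟩ := LinearMap.exists_leftInverse_of_injective φ.linear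
      (LinearMap.ker_eq_bot.2 hlin)
    have hs : ∀ x y, (l.comp r.toContinuousLinearMap) (φ x) ≤ (l.comp r.toContinuousLinearMap) (φ y)
        ↔ l x ≤ l y := by
      intro x y
      have e : ∀ x, φ x = φ.linear x + φ 0 := fun x => congrFun φ.decomp x
      have hr' : ∀ x, r (φ.linear x) = x := fun x => LinearMap.congr_fun hr x
      simp [e x, e y, hr']
    refine ⟨l.comp r.toContinuousLinearMap, ?_⟩
    ext y
    constructor
    · rintro ⟨x, hx, rfl⟩
      rw [hl] at hx
      refine ⟨mem_image_of_mem φ hx.1, forall_mem_image.2 fun z hz => (hs _ _).2 (hx.2 z hz)⟩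
    · rintro ⟨⟨x, hx, rfl⟩, h2⟩
      refine mem_image_of_mem φ ?_
      rw [hl]
      exact ⟨hx, fun z hz => (hs _ _).1 (h2 _ (mem_image_of_mem φ hz))⟩

theorem extremePoints_affineMap_image (hφ : Function.Injective φ) :
    (φ '' P).extremePoints ℝ = φ '' (P.extremePoints ℝ) := by
  ext y
  simp only [mem_extremePoints_iff_left]
  constructor
  · rintro ⟨⟨x, hx, rfl⟩, h⟩
    refine mem_image_of_mem φ ⟨hx, fun a ha b hb hab => ?_⟩
    have := h _ (mem_image_of_mem φ ha) _ (mem_image_of_mem φ hb)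
      (by rw [← image_openSegment]; exact mem_image_of_mem φ hab)
    exact hφ this
  · rintro ⟨x, ⟨hx, h⟩, rfl⟩
    refine ⟨mem_image_of_mem φ hx, ?_⟩
    rintro _ ⟨a, ha, rfl⟩ _ ⟨b, hb, rfl⟩ hab
    rw [← image_openSegment, hφ.mem_set_image] at hab
    exact congrArg φ (h ha hb hab)

theorem finrank_vectorSpan_image (hφ : Function.Injective φ) :
    Module.finrank ℝ (vectorSpan ℝ (φ '' P)) = Module.finrank ℝ (vectorSpan ℝ P) := by
  rw [← AffineMap.map_vectorSpan]
  exact (Submodule.equivMapOfInjective _ (φ.linear_injective_iff.2 hφ) _).finrank_eq.symm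

theorem isKFace_image (hφ : Function.Injective φ) :
    IsKFace (φ '' P) k (φ '' f) ↔ IsKFace P k f := by
  rw [IsKFace, IsKFace, isExposed_image φ hφ, finrank_vectorSpan_image φ hφ, image_nonempty]

theorem bary_image (hφ : Function.Injective φ) (hf : IsFinHull f) (hne : f.Nonempty) :
    bary (φ '' f) = φ (bary f) := by
  have hc := hf.card_extremePoints_pos hne
  have e : ∀ x, φ x = φ.linear x + φ 0 := fun x => congrFun φ.decomp x
  have hncard : (f.extremePoints ℝ).ncard = hf.finite_extremePoints.toFinset.card :=
    Set.ncard_eq_toFinset_card _ hf.finite_extremePoints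
  rw [e, bary, extremePoints_affineMap_image φ hφ, ncard_image_of_injective _ hφ,
    finsum_mem_image hφ.injOn, hf.bary_eq_sum, hncard,
    finsum_mem_eq_finite_toFinset_sum _ hf.finite_extremePoints, map_smul, map_sum]
  rw [Finset.sum_congr rfl fun x _ => e x, Finset.sum_add_distrib, smul_add, Finset.sum_const, ← Nat.cast_smul_eq_nsmul ℝ, smul_smul,
    inv_mul_cancel₀ hc.ne', one_smul]

end AffineImage

open scoped RealInnerProductSpace

/-! ### Parseval's identity for unnormalized orthogonal vectors. -/

section Orthoscheme

/-- Parseval's identity for `n` nonzero orthogonal vectors of an `n`-dimensional space. -/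
theorem sum_inner_sq_div_eq {n : ℕ} {d : ℕ → Eucl n} (hd : ∀ i < n, d i ≠ 0)
    (ho : ∀ i j, i < j → j < n → ⟪d i, d j⟫ = 0) (x : Eucl n) :
    ∑ i ∈ Finset.range n, ⟪d i, x⟫ ^ 2 / ‖d i‖ ^ 2 = ‖x‖ ^ 2 := by
  have hon : Orthonormal ℝ (fun i : Fin n => (‖d i‖)⁻¹ • d i) := by
    constructor
    · intro i
      rw [norm_smul, norm_inv, norm_norm, inv_mul_cancel₀ (norm_ne_zero_iff.2 (hd i i.2))]
    · intro i j hij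
      have : ⟪d i, d j⟫ = 0 := by
        rcases lt_or_gt_of_ne (Fin.val_ne_of_ne hij) with h | h
        · exact ho _ _ h j.2
        · rw [real_inner_comm]; exact ho _ _ h i.2
      simp only [inner_smul_left, inner_smul_right, this, mul_zero]
  have hsp : Submodule.span ℝ (Set.range (fun i : Fin n => (‖d i‖)⁻¹ • d i)) = ⊤ :=
    hon.linearIndependent.span_eq_top_of_card_eq_finrank' (by simp)
  have h := (OrthonormalBasis.mk hon hsp.ge).sum_sq_inner_right x
  rw [← h, Finset.sum_range]
  refine Finset.sum_congr rfl fun i _ => ?_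
  rw [OrthonormalBasis.coe_mk, real_inner_smul_left, mul_pow, inv_pow, div_eq_inv_mul]

theorem eq_zero_of_forall_inner_eq_zero {n : ℕ} {d : ℕ → Eucl n} (hd : ∀ i < n, d i ≠ 0)
    (ho : ∀ i j, i < j → j < n → ⟪d i, d j⟫ = 0) {x : Eucl n} (hx : ∀ i < n, ⟪d i, x⟫ = 0) :
    x = 0 := by
  have h := sum_inner_sq_div_eq hd ho x
  rw [Finset.sum_eq_zero] at h
  · simpa using h.symm
  · intro i hi
    rw [hx i (Finset.mem_range.1 hi)]
    simp

end Orthoscheme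

/-! ### Symmetries acting on faces and flags. -/

section Isometry

variable {n : ℕ} {P f h : Set (Eucl n)} {k : ℕ} {F : ℕ → Set (Eucl n)} (g : Eucl n ≃ᵃⁱ[ℝ] Eucl n)

theorem IsKFace.image_isometry (hg : g '' P = P) (hf : IsKFace P k f) : IsKFace P k (g '' f) := by
  have := (isKFace_image g.toAffineEquiv.toAffineMap g.injective).2 hf
  rwa [show ⇑g.toAffineEquiv.toAffineMap = g from rfl, hg] at this

theorem IsFlag.image_isometry (hg : g '' P = P) (hF : IsFlag P F) :
    IsFlag P (fun k => g '' F k) :=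
  ⟨fun k hk => (hF.1 k hk).image_isometry g hg, fun k hk => image_mono (hF.2.1 k hk), by
    simp only [hF.2.2, hg]⟩

theorem bary_image_isometry (hf : IsFinHull f) (hne : f.Nonempty) :
    bary (g '' f) = g (bary f) :=
  bary_image g.toAffineEquiv.toAffineMap g.injective hf hne

/-- A symmetry fixing the barycenter of a face fixes the face. -/
theorem IsKFace.image_eq_of_bary (hP : IsFinHull P) (hg : g '' P = P) (hf : IsKFace P k f)
    (hb : g (bary f) = bary f) : g '' f = f := by
  refine (IsKFace.eq_of_subset hf (hf.image_isometry g hg) ?_).symm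
  refine (hf.isFinHull hP).subset_of_bary_mem hf.2.1 hP hf.subset (hf.image_isometry g hg).1 ?_
  rw [← hb]
  exact mem_image_of_mem g ((hf.isFinHull hP).bary_mem hf.2.1)

end Isometry

/-! ### Regularity makes the steps between consecutive barycenters orthogonal. -/

section Regular

variable {n : ℕ} {P : Set (Eucl n)} {F : ℕ → Set (Eucl n)} {i j k : ℕ}

theorem IsFlag.bary_mem (hP : IsPolytope P) (hF : IsFlag P F) (hk : k ≤ n) : bary (F k) ∈ F k :=
  (hF.isFinHull hP.isFinHull hk).bary_mem (hF.nonempty hk)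

theorem IsFlag.bary_mem_of_le (hP : IsPolytope P) (hF : IsFlag P F) (hjk : j ≤ k) (hk : k ≤ n) :
    bary (F j) ∈ F k :=
  hF.mono hjk hk (hF.bary_mem hP (hjk.trans hk))

theorem IsFlag.bary_ne (hP : IsPolytope P) (hF : IsFlag P F) (hk : k < n) :
    bary (F (k + 1)) - bary (F k) ≠ 0 := by
  intro h
  rw [sub_eq_zero] at h
  have h1 := hF.isKFace hk.le
  have h2 := hF.isKFace (Nat.succ_le_of_lt hk)
  have h3 := (h2.isFinHull hP.isFinHull).subset_of_bary_mem h2.2.1 hP.isFinHull h2.subset h1.1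
    (h ▸ hF.bary_mem hP hk.le)
  have := h2.le_of_subset h1 h3
  omega

theorem IsFlag.bary_image (hP : IsPolytope P) (hF : IsFlag P F) (hk : k ≤ n)
    (g : Eucl n ≃ᵃⁱ[ℝ] Eucl n) : bary (g '' F k) = g (bary (F k)) :=
  bary_image_isometry g (hF.isFinHull hP.isFinHull hk) (hF.nonempty hk)

theorem IsFlag.map_bary (hP : IsPolytope P) (hF : IsFlag P F) (hk : k ≤ n)
    {g : Eucl n ≃ᵃⁱ[ℝ] Eucl n} (hg : g '' F k = F k) : g (bary (F k)) = bary (F k) := by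
  rw [← hF.bary_image hP hk, hg]

/-- Flags through `v` and through `w` can be chosen to agree with `F` from the `j`-face on. A
symmetry carrying one to the other sends `v` to `w` and fixes the barycenter of `F k`. -/
theorem IsRegular.dist_bary_eq (hP : IsPolytope P) (hR : IsRegular P) (hF : IsFlag P F)
    (hjk : j ≤ k) (hk : k ≤ n) {v w : Eucl n} (hv : v ∈ (F j).extremePoints ℝ)
    (hw : w ∈ (F j).extremePoints ℝ) : dist v (bary (F k)) = dist w (bary (F k)) := by
  obtain ⟨G, hG, hG0, hGF⟩ := hF.exists_flag_of_vertex hP.isFinHull (hjk.trans hk) hv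
  obtain ⟨H, hH, hH0, hHF⟩ := hF.exists_flag_of_vertex hP.isFinHull (hjk.trans hk) hw
  obtain ⟨g, hg, hgG⟩ := hR G H hG hH
  have h0 : g v = w := by
    have := hgG 0 (by omega)
    rw [hG0, hH0, image_singleton] at this
    exact singleton_injective this
  have hk' : g (bary (F k)) = bary (F k) := hF.map_bary hP hk (by
    have := hgG k hk
    rwa [hGF k hjk, hHF k hjk] at this)
  rw [← h0]
  conv_rhs => rw [← hk']
  exact (g.dist_map _ _).symm

/-- The vertices of `F j` are equidistant from both barycenters; subtracting the two equations makes
the inner product with the difference of the barycenters constant on the vertices, hence on `F j`.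
-/
theorem IsRegular.inner_bary_sub (hP : IsPolytope P) (hR : IsRegular P) (hF : IsFlag P F)
    (hjk : j ≤ k) (hk : k ≤ n) {x y : Eucl n} (hx : x ∈ F j) (hy : y ∈ F j) :
    ⟪bary (F k) - bary (F j), x - y⟫ = 0 := by
  have hj := hF.isFinHull hP.isFinHull (hjk.trans hk)
  obtain ⟨w, hw⟩ := hj.extremePoints_nonempty ⟨x, hx⟩
  have key : ∀ x ∈ F j, ⟪bary (F k) - bary (F j), x⟫ = ⟪bary (F k) - bary (F j), w⟫ := by
    refine hj.subset_of_extremePoints_subset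
      (f := {x | ⟪bary (F k) - bary (F j), x⟫ = ⟪bary (F k) - bary (F j), w⟫}) ?_ ?_
    · exact convex_hyperplane (innerSL ℝ (bary (F k) - bary (F j))).toLinearMap.isLinear _
    · intro v hv
      have h1 := hR.dist_bary_eq hP hF hjk hk hv hw
      have h2 := hR.dist_bary_eq hP hF le_rfl (hjk.trans hk) hv hw
      rw [dist_eq_norm, dist_eq_norm] at h1 h2
      have h1' := congrArg (· ^ 2) h1
      have h2' := congrArg (· ^ 2) h2
      simp only [norm_sub_sq_real] at h1' h2'
      show ⟪_, _⟫ = ⟪_, _⟫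
      rw [inner_sub_left, inner_sub_left, real_inner_comm, real_inner_comm v (bary (F j)),
        real_inner_comm w, real_inner_comm w (bary (F j))]
      linarith
  rw [inner_sub_right, key x hx, key y hy, sub_self]

theorem IsRegular.inner_bary_diff (hP : IsPolytope P) (hR : IsRegular P) (hF : IsFlag P F)
    (i j : ℕ) (hij : i < j) (hj : j < n) :
    ⟪bary (F (i + 1)) - bary (F i), bary (F (j + 1)) - bary (F j)⟫ = 0 := by
  rw [real_inner_comm]
  exact hR.inner_bary_sub hP hF (Nat.le_succ j) hj (hF.bary_mem_of_le hP (by omega) hj.le)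
    (hF.bary_mem_of_le hP hij.le hj.le)

theorem IsRegular.eq_zero_of_inner (hP : IsPolytope P) (hR : IsRegular P) (hF : IsFlag P F)
    {x : Eucl n} (hx : ∀ i < n, ⟪bary (F (i + 1)) - bary (F i), x⟫ = 0) : x = 0 :=
  eq_zero_of_forall_inner_eq_zero (d := fun i => bary (F (i + 1)) - bary (F i))
    (fun _ hi => hF.bary_ne hP hi) (hR.inner_bary_diff hP hF) hx

/-- A symmetry of `P` moving only the `k`-face of the flag. -/
theorem IsRegular.exists_symmetry (hP : IsPolytope P) (hR : IsRegular P) (hF : IsFlag P F)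
    (hk : k < n) : ∃ g : Eucl n ≃ᵃⁱ[ℝ] Eucl n, g '' P = P ∧ (∀ j ≤ n, j ≠ k → g '' F j = F j) ∧
      g '' F k ≠ F k := by
  obtain ⟨G, hG, h1, h2⟩ := hF.exists_flagAdj hP.isFinHull hk
  obtain ⟨g, hg, hgF⟩ := hR F G hF hG
  exact ⟨g, hg, fun j hj hjk => by rw [hgF j hj, h1 j hj hjk], by rwa [hgF k hk.le]⟩

end Regular

/-! ### The edge of a flag and its two ends. -/

section Edge

variable {n : ℕ} {P : Set (Eucl n)} {F : ℕ → Set (Eucl n)} {i j k : ℕ}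

theorem IsFlag.eq_singleton_bary (hP : IsPolytope P) (hF : IsFlag P F) : F 0 = {bary (F 0)} := by
  obtain ⟨v, -, hv⟩ := (hF.isKFace (Nat.zero_le n)).eq_singleton
  have := hF.bary_mem hP (Nat.zero_le n)
  rw [hv, mem_singleton_iff] at this
  rw [hv, this]

theorem IsFlag.bary_zero_mem_extremePoints (hP : IsPolytope P) (hF : IsFlag P F) (hk : k ≤ n) :
    bary (F 0) ∈ (F k).extremePoints ℝ := by
  have h0 := (hF.isKFace (Nat.zero_le n)).of_subset (hF.isKFace hk).subset (hF.mono (by omega) hk)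
  rw [← isExtreme_singleton, ← hF.eq_singleton_bary hP]
  exact h0.1.isExtreme

/-- On the line of the edge only two points are as far from `bary (F 1)` as `bary (F 0)` is. Both
must be vertices, or the edge would be a point. -/
theorem IsRegular.extremePoints_edge (hP : IsPolytope P) (hR : IsRegular P) (hF : IsFlag P F)
    (hn : 1 ≤ n) : (F 1).extremePoints ℝ = {bary (F 0), (2 : ℝ) • bary (F 1) - bary (F 0)} := by
  have h1 := hF.isKFace hn
  have hne : bary (F 1) - bary (F 0) ≠ 0 := hF.bary_ne hP hn
  have hb1 := hF.bary_mem hP hn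
  have hb0 := hF.bary_mem_of_le hP (Nat.zero_le 1) hn
  have hsub : (F 1).extremePoints ℝ ⊆ {bary (F 0), (2 : ℝ) • bary (F 1) - bary (F 0)} := by
    intro v hv
    have hfr := h1.2.2
    obtain ⟨c, hc⟩ := (finrank_eq_one_iff_of_nonzero'
      (⟨_, vsub_mem_vectorSpan ℝ hb1 hb0⟩ : vectorSpan ℝ (F 1))
      (by simpa [Subtype.ext_iff] using hne)).1 hfr ⟨_, vsub_mem_vectorSpan ℝ hv.1 hb1⟩
    have hc' : c • (bary (F 1) - bary (F 0)) = v - bary (F 1) := congrArg Subtype.val hc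
    have hd := hR.dist_bary_eq hP hF le_rfl hn hv (hF.bary_zero_mem_extremePoints hP hn)
    rw [dist_eq_norm, ← hc', dist_comm, dist_eq_norm, norm_smul, Real.norm_eq_abs] at hd
    have hc1 : |c| = 1 := by
      have := norm_ne_zero_iff.2 hne
      exact mul_right_cancel₀ this (by rw [hd, one_mul])
    rcases abs_eq zero_le_one |>.1 hc1 with rfl | rfl
    · right
      rw [mem_singleton_iff, two_smul, ← sub_eq_zero]
      rw [← sub_eq_zero] at hc'
      rw [← neg_eq_zero, ← hc']
      module
    · left
      rw [← sub_eq_zero] at hc' ⊢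
      rw [← neg_eq_zero, ← hc']
      module
  refine hsub.antisymm ?_
  rw [insert_subset_iff, singleton_subset_iff]
  refine ⟨hF.bary_zero_mem_extremePoints hP hn, ?_⟩
  by_contra hw
  have hsing : F 1 ⊆ {bary (F 0)} :=
    (hF.isFinHull hP.isFinHull hn).subset_of_extremePoints_subset (convex_singleton _) fun v hv => by
      rcases hsub hv with h | h
      · exact h
      · exact absurd ((mem_singleton_iff.1 h) ▸ hv) hw
  exact hne (sub_eq_zero.2 (hsing hb1))

theorem inner_map_sub_map_sub (g : Eucl n ≃ᵃⁱ[ℝ] Eucl n) (x y z w : Eucl n) :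
    ⟪g x - g y, g z - g w⟫ = ⟪x - y, z - w⟫ := by
  have h : ∀ x y, g x - g y = g.linearIsometryEquiv (x - y) := fun x y =>
    (g.map_vsub x y).symm
  rw [h, h, LinearIsometryEquiv.inner_map_map]

end Edge

/-! ### Edges are tangent at their midpoints, and the polytope is centred at the origin. -/

section EdgeScribed

variable {n : ℕ} {P : Set (Eucl n)} {F : ℕ → Set (Eucl n)} {i j k : ℕ}

/-- Here `bary (F 0) + σ • (bary (F 1) - bary (F 0))` is the point of tangency. Symmetries of `P`
are not yet known to fix the origin, so that `σ = 1` still needs an argument. The sign of `σ` is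
recorded in order to recover it from its square. -/
theorem IsRegularEdgeScribed.exists_tangent (hP : IsRegularEdgeScribed P) (hF : IsFlag P F)
    (hn : 1 ≤ n) : ∃ σ : ℝ, 0 ≤ σ ∧
      ⟪bary (F 0), bary (F 1) - bary (F 0)⟫ = -σ * ‖bary (F 1) - bary (F 0)‖ ^ 2 ∧
      ‖bary (F 0)‖ ^ 2 = 1 + σ ^ 2 * ‖bary (F 1) - bary (F 0)‖ ^ 2 := by
  have hne : bary (F 1) - bary (F 0) ≠ 0 := hF.bary_ne hP.isPolytope hn
  obtain ⟨x, hx, hx1, hmin⟩ := hP.isEdgeScribed _ (hF.isKFace hn)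
  have hb1 := hF.bary_mem hP.isPolytope hn
  have hb0 := hF.bary_mem_of_le hP.isPolytope (Nat.zero_le 1) hn
  have hF1 := (hF.isFinHull hP.isPolytope.isFinHull hn).convexHull_extremePoints
  rw [hP.isRegular.extremePoints_edge hP.isPolytope hF hn, convexHull_pair] at hF1
  rw [← hF1, segment_eq_image'] at hx
  obtain ⟨τ, hτ, rfl⟩ := hx
  set e := bary (F 1) - bary (F 0) with he
  have he2 : 0 < ‖e‖ ^ 2 := by positivity
  have hxe : bary (F 0) + τ • ((2 : ℝ) • bary (F 1) - bary (F 0) - bary (F 0)) =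
      bary (F 0) + (2 * τ) • e := by rw [he]; module
  simp only [hxe] at hx1
  have hline : ∀ t : ℝ, 1 ≤ ‖bary (F 0) + (2 * τ) • e + t • e‖ := fun t => by
    apply hmin
    have := AffineMap.lineMap_mem (2 * τ + t) (subset_affineSpan ℝ _ hb0) (subset_affineSpan ℝ _ hb1)
    rw [AffineMap.lineMap_apply, vsub_eq_sub, vadd_eq_add] at this
    convert this using 1
    module
  have h0 : ⟪bary (F 0) + (2 * τ) • e, e⟫ = 0 := by
    set y := bary (F 0) + (2 * τ) • e
    -- The parameter of the foot of the perpendicular from the origin, where minimality of the norm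
    -- is most restrictive.
    have h := hline (-⟪y, e⟫ / ‖e‖ ^ 2)
    have h' : 1 ≤ ‖y + (-⟪y, e⟫ / ‖e‖ ^ 2) • e‖ ^ 2 := by nlinarith
    rw [norm_add_sq_real, hx1, inner_smul_right, norm_smul, mul_pow, Real.norm_eq_abs, sq_abs,
      div_pow] at h'
    have h2 : ⟪y, e⟫ ^ 2 / ‖e‖ ^ 2 ≤ 0 := by
      have e1 : (-⟪y, e⟫) ^ 2 / (‖e‖ ^ 2) ^ 2 * ‖e‖ ^ 2 = ⟪y, e⟫ ^ 2 / ‖e‖ ^ 2 := by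
        field_simp
      have e2 : 2 * (-⟪y, e⟫ / ‖e‖ ^ 2 * ⟪y, e⟫) = -2 * (⟪y, e⟫ ^ 2 / ‖e‖ ^ 2) := by
        field_simp
      rw [e1, e2] at h'
      linarith
    have h3 : 0 ≤ ⟪y, e⟫ ^ 2 / ‖e‖ ^ 2 := by positivity
    have h4 : ⟪y, e⟫ ^ 2 / ‖e‖ ^ 2 = 0 := le_antisymm h2 h3
    rw [div_eq_zero_iff] at h4
    rcases h4 with h4 | h4
    · exact pow_eq_zero_iff two_ne_zero |>.1 h4
    · exact absurd h4 he2.ne'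
  have h1 : ⟪bary (F 0), e⟫ = -(2 * τ) * ‖e‖ ^ 2 := by
    rw [inner_add_left, inner_smul_left, real_inner_self_eq_norm_sq] at h0
    simp only [conj_trivial] at h0
    linarith
  refine ⟨2 * τ, by linarith [hτ.1], h1, ?_⟩
  have h2 : ‖bary (F 0) + (2 * τ) • e‖ ^ 2 = 1 := by rw [hx1]; norm_num
  rw [norm_add_sq_real, inner_smul_right, h1, norm_smul, mul_pow, Real.norm_eq_abs, sq_abs] at h2
  linarith

/-- The symmetry moving only the edge gives a second edge at the same vertex, of the same length and
hence with the same `σ`. So `bary (F 0)` is orthogonal to the displacement `z` of the edge's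
midpoint, and this transfers the tangency relation from the first step to the second. -/
theorem IsRegularEdgeScribed.exists_tangent_two (hP : IsRegularEdgeScribed P) (hF : IsFlag P F)
    (hn : 2 ≤ n) : ∃ σ : ℝ,
      ⟪bary (F 0), bary (F 1) - bary (F 0)⟫ = -σ * ‖bary (F 1) - bary (F 0)‖ ^ 2 ∧
      ‖bary (F 0)‖ ^ 2 = 1 + σ ^ 2 * ‖bary (F 1) - bary (F 0)‖ ^ 2 ∧
      ⟪bary (F 0), bary (F 2) - bary (F 1)⟫ = -σ * ‖bary (F 2) - bary (F 1)‖ ^ 2 := by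
  have hPp := hP.isPolytope
  have hne0 : bary (F 1) - bary (F 0) ≠ 0 := hF.bary_ne hPp (by omega)
  have hne1 : bary (F 2) - bary (F 1) ≠ 0 := hF.bary_ne hPp (by omega)
  obtain ⟨σ, hσ0, hσ1, hσ2⟩ := hP.exists_tangent hF (by omega)
  refine ⟨σ, hσ1, hσ2, ?_⟩
  obtain ⟨g, hg, hgF, hgne⟩ := hP.isRegular.exists_symmetry hPp hF (k := 1) (by omega)
  have hfix : ∀ j ≤ n, j ≠ 1 → g (bary (F j)) = bary (F j) := fun j hj hj1 =>
    hF.map_bary hPp hj (hgF j hj hj1)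
  have hz : g (bary (F 1)) - bary (F 1) ≠ 0 := fun h => hgne
    ((hF.isKFace (by omega)).image_eq_of_bary g hPp.isFinHull hg (sub_eq_zero.1 h))
  obtain ⟨σ', hσ0', hσ1', hσ2'⟩ := hP.exists_tangent (hF.image_isometry g hg) (by omega)
  rw [hF.bary_image hPp (by omega), hF.bary_image hPp (by omega), hfix 0 (by omega) (by omega)]
    at hσ1' hσ2'
  have hl : ‖g (bary (F 1)) - bary (F 0)‖ = ‖bary (F 1) - bary (F 0)‖ := by
    have := g.dist_map (bary (F 1)) (bary (F 0))
    rwa [hfix 0 (by omega) (by omega), dist_eq_norm, dist_eq_norm] at this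
  rw [hl] at hσ1' hσ2'
  have hl2 : 0 < ‖bary (F 1) - bary (F 0)‖ ^ 2 := by positivity
  have ha2 : 0 < ‖bary (F 2) - bary (F 1)‖ ^ 2 := by positivity
  have hσσ : σ' = σ := by
    have : σ' ^ 2 = σ ^ 2 := by
      apply mul_right_cancel₀ hl2.ne'
      linarith
    exact (pow_left_inj₀ hσ0' hσ0 two_ne_zero).1 this
  set z := g (bary (F 1)) - bary (F 1) with hzdef
  have hbz : ⟪bary (F 0), z⟫ = 0 := by
    have : z = (g (bary (F 1)) - bary (F 0)) - (bary (F 1) - bary (F 0)) := by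
      rw [hzdef]; abel
    rw [this, inner_sub_right, hσ1', hσ1, hσσ, sub_self]
  have hinv : ∀ i ≤ n, ∀ j ≤ n, i ≠ 1 → j ≠ 1 → ⟪bary (F i) - bary (F j), z⟫ = 0 := by
    intro i hi j hj hi1 hj1
    have h := inner_map_sub_map_sub g (bary (F i)) (bary (F j)) (bary (F 1)) (bary (F j))
    rw [hfix i hi hi1, hfix j hj hj1] at h
    have : z = (g (bary (F 1)) - bary (F j)) - (bary (F 1) - bary (F j)) := by
      rw [hzdef]; abel
    rw [this, inner_sub_right, h, sub_self]
  have ho : ⟪bary (F 1) - bary (F 0), bary (F 2) - bary (F 1)⟫ = 0 :=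
    hP.isRegular.inner_bary_diff hPp hF 0 1 (by omega) (by omega)
  set c := ⟪bary (F 1) - bary (F 0), z⟫ with hc
  have hc1 : ⟪bary (F 2) - bary (F 1), z⟫ = -c := by
    have h := hinv 2 (by omega) 0 (by omega) (by omega) (by omega)
    rw [← sub_add_sub_cancel _ (bary (F 1)), inner_add_left] at h
    linarith
  set d₀ := bary (F 1) - bary (F 0) with hd0
  set d₁ := bary (F 2) - bary (F 1) with hd1
  -- `z` is orthogonal to `d₀ + d₁` and to every later step, which determines it up to a factor.
  have hzeq : z - c • ((‖d₀‖ ^ 2)⁻¹ • d₀ - (‖d₁‖ ^ 2)⁻¹ • d₁) = 0 := by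
    apply hP.isRegular.eq_zero_of_inner hPp hF
    intro i hi
    obtain rfl | rfl | hi2 : i = 0 ∨ i = 1 ∨ 2 ≤ i := by omega
    · show ⟪d₀, _⟫ = 0
      simp only [inner_sub_right, inner_smul_right, ho, real_inner_self_eq_norm_sq, ← hc]
      field_simp
      ring
    · show ⟪d₁, _⟫ = 0
      simp only [inner_sub_right, inner_smul_right, hc1, real_inner_self_eq_norm_sq,
        real_inner_comm d₀ d₁, ho]
      field_simp
      ring
    · have h0 := hP.isRegular.inner_bary_diff hPp hF 0 i (by omega) hi
      have h1 := hP.isRegular.inner_bary_diff hPp hF 1 i (by omega) hi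
      rw [real_inner_comm] at h0 h1
      have h0' : ⟪bary (F (i + 1)) - bary (F i), d₀⟫ = 0 := h0
      have h1' : ⟪bary (F (i + 1)) - bary (F i), d₁⟫ = 0 := h1
      rw [inner_sub_right _ z, inner_smul_right, inner_sub_right _ ((‖d₀‖ ^ 2)⁻¹ • d₀),
        inner_smul_right, inner_smul_right, hinv (i + 1) hi i hi.le (by omega) (by omega), h0', h1']
      ring
  rw [sub_eq_zero] at hzeq
  have hc0 : c ≠ 0 := by
    intro h
    rw [h, zero_smul] at hzeq
    exact hz hzeq
  rw [hzeq, inner_smul_right, inner_sub_right, inner_smul_right, inner_smul_right, hσ1] at hbz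
  have h2 := (mul_eq_zero.1 hbz).resolve_left hc0
  field_simp at h2
  linarith

/-- Exchanging the ends of the edge does not change the inner product of the end with the second
step, since the first two steps are orthogonal. By `exists_tangent_two` both ends therefore have the
same `σ`, so the edge is tangent at its midpoint and `σ = 1`. -/
theorem IsRegularEdgeScribed.norm_bary_zero_sq (hP : IsRegularEdgeScribed P) (hF : IsFlag P F)
    (hn : 2 ≤ n) : ‖bary (F 0)‖ ^ 2 = 1 + ‖bary (F 1) - bary (F 0)‖ ^ 2 ∧ ‖bary (F 1)‖ = 1 := by
  have hPp := hP.isPolytope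
  have hne0 : bary (F 1) - bary (F 0) ≠ 0 := hF.bary_ne hPp (by omega)
  have hne1 : bary (F 2) - bary (F 1) ≠ 0 := hF.bary_ne hPp (by omega)
  obtain ⟨σ, h1, h2, h3⟩ := hP.exists_tangent_two hF hn
  obtain ⟨g, hg, hgF, hgne⟩ := hP.isRegular.exists_symmetry hPp hF (k := 0) (by omega)
  have hfix : ∀ j ≤ n, j ≠ 0 → g (bary (F j)) = bary (F j) := fun j hj hj1 =>
    hF.map_bary hPp hj (hgF j hj hj1)
  obtain ⟨σ', h1', -, h3'⟩ := hP.exists_tangent_two (hF.image_isometry g hg) hn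
  rw [hF.bary_image hPp (by omega), hF.bary_image hPp (by omega), hfix 1 (by omega) (by omega)]
    at h1'
  rw [hF.bary_image hPp (by omega), hF.bary_image hPp (by omega), hF.bary_image hPp (by omega),
    hfix 1 (by omega) (by omega), hfix 2 (by omega) (by omega)] at h3'
  have hg0 : g (bary (F 0)) = (2 : ℝ) • bary (F 1) - bary (F 0) := by
    have h := (hF.image_isometry g hg).bary_zero_mem_extremePoints hPp (k := 1) (by omega)
    simp only [hgF 1 (by omega) one_ne_zero] at h
    rw [hP.isRegular.extremePoints_edge hPp hF (by omega), hF.bary_image hPp (by omega)] at h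
    refine h.resolve_left fun h0 => hgne ?_
    exact (hF.isKFace (by omega)).image_eq_of_bary g hPp.isFinHull hg h0
  have ho : ⟪bary (F 1) - bary (F 0), bary (F 2) - bary (F 1)⟫ = 0 :=
    hP.isRegular.inner_bary_diff hPp hF 0 1 (by omega) (by omega)
  have hl2 : 0 < ‖bary (F 1) - bary (F 0)‖ ^ 2 := by positivity
  have ha2 : 0 < ‖bary (F 2) - bary (F 1)‖ ^ 2 := by positivity
  rw [hg0] at h1' h3'
  set d₀ := bary (F 1) - bary (F 0) with hd0
  set d₁ := bary (F 2) - bary (F 1) with hd1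
  have e1 : (2 : ℝ) • bary (F 1) - bary (F 0) = bary (F 0) + (2 : ℝ) • d₀ := by
    rw [hd0]; module
  have e2 : bary (F 1) - ((2 : ℝ) • bary (F 1) - bary (F 0)) = -d₀ := by
    rw [hd0]; module
  rw [e2, e1, inner_neg_right, inner_add_left, inner_smul_left, real_inner_self_eq_norm_sq, h1,
    norm_neg] at h1'
  rw [e1, inner_add_left, inner_smul_left, h3, ho, mul_zero, add_zero] at h3'
  have hσ : σ' = σ := by
    apply mul_right_cancel₀ ha2.ne'
    linarith
  simp only [conj_trivial, hσ] at h1'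
  have hσ1 : σ = 1 := by
    apply mul_right_cancel₀ hl2.ne'
    linarith
  subst hσ1
  refine ⟨by linarith, ?_⟩
  have e3 : bary (F 1) = bary (F 0) + d₀ := by rw [hd0]; abel
  have : ‖bary (F 1)‖ ^ 2 = 1 := by
    rw [e3, norm_add_sq_real, h1, h2]
    ring
  exact (pow_eq_one_iff_of_nonneg (norm_nonneg _) two_ne_zero).1 this

theorem IsRegularEdgeScribed.norm_edge_eq (hP : IsRegularEdgeScribed P) (hF : IsFlag P F)
    {G : ℕ → Set (Eucl n)} (hG : IsFlag P G) (hn : 1 ≤ n) :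
    ‖bary (G 1) - bary (G 0)‖ = ‖bary (F 1) - bary (F 0)‖ := by
  obtain ⟨g, -, hgF⟩ := hP.isRegular F G hF hG
  rw [← hgF 1 hn, ← hgF 0 (by omega), hF.bary_image hP.isPolytope hn,
    hF.bary_image hP.isPolytope (by omega), ← dist_eq_norm, ← dist_eq_norm, g.dist_map]

theorem IsRegularEdgeScribed.norm_vertex_sq (hP : IsRegularEdgeScribed P) (hF : IsFlag P F)
    (hn : 2 ≤ n) {v : Eucl n} (hv : v ∈ P.extremePoints ℝ) :
    ‖v‖ ^ 2 = 1 + ‖bary (F 1) - bary (F 0)‖ ^ 2 := by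
  have hv' : v ∈ (F n).extremePoints ℝ := by rwa [hF.2.2]
  obtain ⟨G, hG, hG0, -⟩ := hF.exists_flag_of_vertex hP.isPolytope.isFinHull le_rfl hv'
  have h := (hP.norm_bary_zero_sq hG hn).1
  have hb := hG.bary_mem hP.isPolytope (Nat.zero_le n)
  rw [hG0, mem_singleton_iff, ← hG0] at hb
  rw [hb] at h
  rw [h, ← hb, hP.norm_edge_eq hF hG (by omega)]

/-- The vertices are equidistant both from the origin and from `bary P`, so `⟪bary P, ·⟫` is
constant on a full-dimensional set. -/
theorem IsRegularEdgeScribed.bary_self (hP : IsRegularEdgeScribed P) (hn : 2 ≤ n) :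
    bary P = 0 := by
  obtain ⟨F, hF⟩ := hP.isPolytope.exists_flag
  have hPp := hP.isPolytope
  obtain ⟨w, hw⟩ := hPp.isFinHull.extremePoints_nonempty hPp.isKFace_self.2.1
  have key : P ⊆ {x | ⟪bary P, x⟫ = ⟪bary P, w⟫} := by
    refine hPp.isFinHull.subset_of_extremePoints_subset ?_ ?_
    · exact convex_hyperplane (innerSL ℝ (bary P)).toLinearMap.isLinear _
    · intro v hv
      have h1 := hP.norm_vertex_sq hF hn hv
      have h2 := hP.norm_vertex_sq hF hn hw
      have h3 := hP.isRegular.dist_bary_eq hPp hF (j := n) le_rfl le_rfl (v := v) (w := w)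
        (by rwa [hF.2.2]) (by rwa [hF.2.2])
      rw [hF.2.2, dist_eq_norm, dist_eq_norm] at h3
      have h3' := congrArg (· ^ 2) h3
      simp only [norm_sub_sq_real] at h3'
      show ⟪_, _⟫ = ⟪_, _⟫
      rw [real_inner_comm, real_inner_comm w]
      linarith
  have h : bary P ∈ (vectorSpan ℝ P)ᗮ := by
    rw [Submodule.mem_orthogonal', vectorSpan_def]
    intro u hu
    induction hu using Submodule.span_induction with
    | mem x hx =>
      obtain ⟨a, ha, b, hb, rfl⟩ := hx
      show ⟪bary P, a - b⟫ = 0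
      rw [inner_sub_right, key ha, key hb, sub_self]
    | zero => simp
    | add x y _ _ hx hy => rw [inner_add_right, hx, hy, add_zero]
    | smul a x _ hx => rw [inner_smul_right, hx, mul_zero]
  rw [← direction_affineSpan, hPp.2, AffineSubspace.direction_top, Submodule.top_orthogonal_eq_bot]
    at h
  exact h

theorem IsRegularEdgeScribed.hasHalfEdgeLength (hP : IsRegularEdgeScribed P) (hF : IsFlag P F)
    (hn : 1 ≤ n) : HasHalfEdgeLength P ‖bary (F 1) - bary (F 0)‖ := by
  intro u v huv
  obtain ⟨G, hG, hG1⟩ := hP.isPolytope.exists_flag_of_face huv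
  have hext := hP.isRegular.extremePoints_edge hP.isPolytope hG hn
  have hsub : (G 1).extremePoints ℝ ⊆ {u, v} := by
    rw [hG1, ← convexHull_pair]
    exact extremePoints_convexHull_subset
  rw [hext, insert_subset_iff, singleton_subset_iff] at hsub
  have hne : bary (G 1) - bary (G 0) ≠ 0 := hG.bary_ne hP.isPolytope hn
  rw [← hP.norm_edge_eq hF hG hn]
  have e : dist (bary (G 0)) ((2 : ℝ) • bary (G 1) - bary (G 0)) =
      2 * ‖bary (G 1) - bary (G 0)‖ := by
    rw [dist_comm, dist_eq_norm, show (2 : ℝ) • bary (G 1) - bary (G 0) - bary (G 0) =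
      (2 : ℝ) • (bary (G 1) - bary (G 0)) by module, norm_smul]
    norm_num
  have hne' : dist (bary (G 0)) ((2 : ℝ) • bary (G 1) - bary (G 0)) ≠ 0 := by
    rw [e]
    exact mul_ne_zero two_ne_zero (norm_ne_zero_iff.2 hne)
  rw [← e]
  rcases hsub with ⟨h1 | h1, h2 | h2⟩
  · rw [h2, h1] at hne'; simp at hne'
  · rw [mem_singleton_iff.1 h2, h1]
  · rw [h2, mem_singleton_iff.1 h1, dist_comm]
  · rw [mem_singleton_iff.1 h2, mem_singleton_iff.1 h1] at hne'; simp at hne'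

theorem IsRegularEdgeScribed.map_zero (hP : IsRegularEdgeScribed P) (hn : 2 ≤ n)
    {g : Eucl n ≃ᵃⁱ[ℝ] Eucl n} (hg : g '' P = P) : g 0 = 0 := by
  have := bary_image_isometry g hP.isPolytope.isFinHull hP.isPolytope.isKFace_self.2.1
  rwa [hg, hP.bary_self hn, eq_comm] at this

theorem IsRegularEdgeScribed.bary_last (hP : IsRegularEdgeScribed P) (hF : IsFlag P F)
    (hn : 2 ≤ n) : bary (F n) = 0 := by
  rw [hF.2.2, hP.bary_self hn]

end EdgeScribed

/-! ### Normals of the chamber walls and the fundamental reflections. -/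

section Normals

variable {n : ℕ} {P : Set (Eucl n)} {F G : ℕ → Set (Eucl n)} {i j k : ℕ}

/-- The steps between consecutive barycenters of a flag, divided by their squared lengths. The index
is shifted by one, and the sequence starts with `0`. -/
noncomputable def stepCovec (F : ℕ → Set (Eucl n)) : ℕ → Eucl n
  | 0 => 0
  | k + 1 => (‖bary (F (k + 1)) - bary (F k)‖ ^ 2)⁻¹ • (bary (F (k + 1)) - bary (F k))

/-- A normal vector of the wall opposite to the barycenter of the `k`-face. -/
noncomputable def wallNormal (F : ℕ → Set (Eucl n)) (k : ℕ) : Eucl n := stepCovec F k - stepCovec F (k + 1)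

variable (hP : IsRegularEdgeScribed P) (hn : 2 ≤ n) (hF : IsFlag P F)

include hP hF

theorem IsRegularEdgeScribed.inner_step (hi : i < n) (hj : j < n) :
    ⟪bary (F (i + 1)) - bary (F i), bary (F (j + 1)) - bary (F j)⟫ =
      if i = j then ‖bary (F (i + 1)) - bary (F i)‖ ^ 2 else 0 := by
  split_ifs with h
  · subst h
    exact real_inner_self_eq_norm_sq _
  · rcases lt_or_gt_of_ne h with h | h
    · exact hP.isRegular.inner_bary_diff hP.isPolytope hF i j h hj
    · rw [real_inner_comm]
      exact hP.isRegular.inner_bary_diff hP.isPolytope hF j i h hi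

theorem IsRegularEdgeScribed.norm_step_sq_pos (hi : i < n) :
    0 < ‖bary (F (i + 1)) - bary (F i)‖ ^ 2 := by
  have := norm_pos_iff.2 (hF.bary_ne hP.isPolytope hi)
  positivity

theorem IsRegularEdgeScribed.inner_stepCovec_step (hk : k < n) (hi : i < n) :
    ⟪stepCovec F (k + 1), bary (F (i + 1)) - bary (F i)⟫ = if k = i then 1 else 0 := by
  rw [stepCovec, real_inner_smul_left, hP.inner_step hF hk hi]
  split_ifs
  · exact inv_mul_cancel₀ (hP.norm_step_sq_pos hF hk).ne'
  · rw [mul_zero]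

theorem IsRegularEdgeScribed.norm_stepCovec_sq (hk : k < n) :
    ‖stepCovec F (k + 1)‖ ^ 2 = (‖bary (F (k + 1)) - bary (F k)‖ ^ 2)⁻¹ := by
  have := (hP.norm_step_sq_pos hF hk).ne'
  rw [stepCovec, norm_smul, norm_inv, norm_pow, norm_norm]
  field_simp

theorem IsRegularEdgeScribed.inner_stepCovec (hk : k ≤ n) (hi : i ≤ n) (hik : i ≠ k) :
    ⟪stepCovec F i, stepCovec F k⟫ = 0 := by
  cases i with
  | zero => simp [stepCovec]
  | succ i =>
    cases k with
    | zero => simp [stepCovec]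
    | succ k =>
      rw [stepCovec, stepCovec, real_inner_smul_left, real_inner_smul_right,
        hP.inner_step hF hi hk, if_neg (by omega)]
      simp

theorem IsRegularEdgeScribed.norm_wallNormal_sq (hk : k < n) :
    ‖wallNormal F k‖ ^ 2 = ‖stepCovec F k‖ ^ 2 + ‖stepCovec F (k + 1)‖ ^ 2 := by
  rw [wallNormal, norm_sub_sq_real, hP.inner_stepCovec hF hk hk.le (by omega)]
  ring

theorem IsRegularEdgeScribed.norm_wallNormal_sq_pos (hk : k < n) : 0 < ‖wallNormal F k‖ ^ 2 := by
  rw [hP.norm_wallNormal_sq hF hk, hP.norm_stepCovec_sq hF hk]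
  have := inv_pos.2 (hP.norm_step_sq_pos hF hk)
  positivity

theorem IsRegularEdgeScribed.inner_wallNormal_succ (hk : k + 1 < n) :
    ⟪wallNormal F k, wallNormal F (k + 1)⟫ = -‖stepCovec F (k + 1)‖ ^ 2 := by
  rw [wallNormal, wallNormal, inner_sub_left, inner_sub_right, inner_sub_right,
    hP.inner_stepCovec hF (by omega) (by omega) (by omega : k ≠ k + 1),
    hP.inner_stepCovec hF (by omega) (by omega) (by omega : k ≠ k + 1 + 1),
    hP.inner_stepCovec hF (by omega) (by omega) (by omega : k + 1 ≠ k + 1 + 1),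
    real_inner_self_eq_norm_sq]
  ring

theorem IsRegularEdgeScribed.inner_wallNormal_step (hk : k < n) (hi : i < n) :
    ⟪wallNormal F k, bary (F (i + 1)) - bary (F i)⟫ =
      (if i + 1 = k then 1 else 0) - if i = k then 1 else 0 := by
  rw [wallNormal, inner_sub_left, hP.inner_stepCovec_step hF hk hi]
  congr 1
  · cases k with
    | zero => simp [stepCovec]
    | succ k =>
      rw [hP.inner_stepCovec_step hF (by omega) hi]
      simp [eq_comm]
  · simp [eq_comm]

theorem IsRegularEdgeScribed.eq_zero_of_inner_wallNormal {x : Eucl n}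
    (hx : ∀ k < n, ⟪wallNormal F k, x⟫ = 0) : x = 0 := by
  have key : ∀ k ≤ n, ⟪stepCovec F k, x⟫ = 0 := by
    intro k
    induction k with
    | zero => simp [stepCovec]
    | succ k ih =>
      intro hk
      have := hx k hk
      rw [wallNormal, inner_sub_left, ih (by omega)] at this
      linarith
  apply hP.isRegular.eq_zero_of_inner hP.isPolytope hF
  intro i hi
  have h := key (i + 1) hi
  rw [stepCovec, real_inner_smul_left] at h
  exact (mul_eq_zero.1 h).resolve_left (inv_pos.2 (hP.norm_step_sq_pos hF hi)).ne'

include hn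

/-- The normals of the walls form the basis dual to the barycenters. -/
theorem IsRegularEdgeScribed.inner_wallNormal_bary (hk : k < n) (hj : j ≤ n) :
    ⟪wallNormal F k, bary (F j)⟫ = if j = k then 1 else 0 := by
  -- Downward from the center `bary (F n) = 0`, one step at a time.
  induction hj using Nat.decreasingInduction with
  | self => rw [hP.bary_last hF hn, inner_zero_right, if_neg (by omega)]
  | of_succ j hj ih =>
    have h := hP.inner_wallNormal_step hF hk hj
    rw [inner_sub_right, ih] at h
    linarith

theorem IsRegularEdgeScribed.eq_sum_bary (x : Eucl n) :
    x = ∑ j ∈ Finset.range n, ⟪wallNormal F j, x⟫ • bary (F j) := by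
  rw [← sub_eq_zero]
  apply hP.eq_zero_of_inner_wallNormal hF
  intro k hk
  rw [inner_sub_right, inner_sum, sub_eq_zero]
  symm
  rw [Finset.sum_eq_single k]
  · rw [real_inner_smul_right, hP.inner_wallNormal_bary hn hF hk hk.le, if_pos rfl, mul_one]
  · intro j hj hjk
    rw [real_inner_smul_right, hP.inner_wallNormal_bary hn hF hk (Finset.mem_range.1 hj).le,
      if_neg hjk, mul_zero]
  · intro h
    exact absurd (Finset.mem_range.2 hk) h

theorem IsRegularEdgeScribed.eq_smul_wallNormal (hk : k < n) {x : Eucl n}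
    (hx : ∀ j < n, j ≠ k → ⟪bary (F j), x⟫ = 0) : x = ⟪bary (F k), x⟫ • wallNormal F k := by
  have key : ∀ j ≤ n, ⟪bary (F j), x - ⟪bary (F k), x⟫ • wallNormal F k⟫ = 0 := by
    intro j hj
    rw [inner_sub_right, real_inner_smul_right, real_inner_comm,
      real_inner_comm (wallNormal F k) (bary (F j)), hP.inner_wallNormal_bary hn hF hk hj]
    split_ifs with h
    · rw [h, real_inner_comm]; ring
    · rcases hj.lt_or_eq with h' | h'
      · rw [real_inner_comm, hx j h' h]; ring
      · rw [h', hP.bary_last hF hn]; simp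
  rw [← sub_eq_zero]
  apply hP.isRegular.eq_zero_of_inner hP.isPolytope hF
  intro i hi
  rw [inner_sub_left, key _ hi, key _ hi.le, sub_self]

theorem IsRegularEdgeScribed.map_eq_sum {g : Eucl n ≃ᵃⁱ[ℝ] Eucl n} (hg : g 0 = 0) (x : Eucl n) :
    g x = ∑ j ∈ Finset.range n, ⟪wallNormal F j, x⟫ • g (bary (F j)) := by
  have hlin : ∀ x, g x = g.linearIsometryEquiv x := fun x => by
    have := g.map_vsub x 0
    rw [hg] at this
    simpa using this.symm
  conv_lhs => rw [hP.eq_sum_bary hn hF x, hlin, map_sum]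
  refine Finset.sum_congr rfl fun j _ => ?_
  rw [map_smul, hlin]

theorem IsRegularEdgeScribed.isometry_ext {g h : Eucl n ≃ᵃⁱ[ℝ] Eucl n} (hg : g 0 = 0)
    (hh : h 0 = 0) (hgh : ∀ j < n, g (bary (F j)) = h (bary (F j))) : g = h := by
  ext1 x
  rw [hP.map_eq_sum hn hF hg, hP.map_eq_sum hn hF hh]
  exact Finset.sum_congr rfl fun j hj => by rw [hgh j (Finset.mem_range.1 hj)]

/-- The wall contains `bary (F n) = 0`, so it is the linear span of the barycenters other than the
`k`-th, that is, the hyperplane orthogonal to `wallNormal F k`. -/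
theorem IsRegularEdgeScribed.fundRefl_apply (hk : k < n) (x : Eucl n) :
    fundRefl F k x = x - (2 * ⟪wallNormal F k, x⟫ / ‖wallNormal F k‖ ^ 2) • wallNormal F k := by
  have hν := hP.norm_wallNormal_sq_pos hF hk
  set ν := wallNormal F k with hνdef
  set c := ⟪ν, x⟫ / ‖ν‖ ^ 2 with hc
  have h0 : (0 : Eucl n) ∈ wall F k := by
    have : bary (F n) ∈ wall F k := subset_affineSpan ℝ _ (mem_insert _ _)
    rwa [hP.bary_last hF hn] at this
  have hb : ∀ j < n, j ≠ k → bary (F j) ∈ (wall F k).direction := fun j hj hjk => by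
    have : bary (F j) ∈ wall F k := subset_affineSpan ℝ _ (mem_insert_of_mem _ ⟨j, hj, hjk, rfl⟩)
    simpa using AffineSubspace.vsub_mem_direction this h0
  have hp : x - c • ν ∈ wall F k := by
    have h1 : x - c • ν ∈ (wall F k).direction := by
      rw [hP.eq_sum_bary hn hF (x - c • ν)]
      refine Submodule.sum_mem _ fun j hj => ?_
      by_cases hjk : j = k
      · subst hjk
        rw [← hνdef, inner_sub_right, real_inner_smul_right, real_inner_self_eq_norm_sq, hc,
          div_mul_cancel₀ _ hν.ne', sub_self, zero_smul]
        exact Submodule.zero_mem _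
      · exact Submodule.smul_mem _ _ (hb j (Finset.mem_range.1 hj) hjk)
    simpa using AffineSubspace.vadd_mem_of_mem_direction h1 h0
  have hort : ∀ y ∈ insert (bary (F n)) {x | ∃ j < n, j ≠ k ∧ x = bary (F j)}, ⟪ν, y⟫ = 0 := by
    rintro y (rfl | ⟨j, hj, hjk, rfl⟩)
    · rw [hP.bary_last hF hn, inner_zero_right]
    · rw [hP.inner_wallNormal_bary hn hF hk hj.le, if_neg hjk]
  have hv : c • ν ∈ (wall F k).directionᗮ := by
    apply Submodule.smul_mem
    rw [Submodule.mem_orthogonal', wall, direction_affineSpan, vectorSpan_def]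
    intro u hu
    induction hu using Submodule.span_induction with
    | mem x hx =>
      obtain ⟨a, ha, b, hb, rfl⟩ := hx
      show ⟪ν, a - b⟫ = 0
      rw [inner_sub_right, hort a ha, hort b hb, sub_self]
    | zero => simp
    | add x y _ _ hx hy => rw [inner_add_right, hx, hy, add_zero]
    | smul a x _ hx => rw [inner_smul_right, hx, mul_zero]
  have h := EuclideanGeometry.reflection_orthogonal_vadd hp hv
  rw [vadd_eq_add, vadd_eq_add] at h
  have hx : c • ν + (x - c • ν) = x := by abel
  rw [hx] at h
  rw [fundRefl, h, mul_div_assoc, ← hc]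
  module

theorem IsRegularEdgeScribed.fundRefl_zero (hk : k < n) : fundRefl F k 0 = 0 := by
  rw [hP.fundRefl_apply hn hF hk]
  simp

theorem IsRegularEdgeScribed.fundRefl_bary (hk : k < n) (hj : j ≤ n) (hjk : j ≠ k) :
    fundRefl F k (bary (F j)) = bary (F j) := by
  rw [hP.fundRefl_apply hn hF hk, hP.inner_wallNormal_bary hn hF hk hj, if_neg hjk]
  simp

theorem IsRegularEdgeScribed.eq_one_of_image_eq {g : Eucl n ≃ᵃⁱ[ℝ] Eucl n} (hg : g '' P = P)
    (hgF : ∀ j ≤ n, g '' F j = F j) : g = 1 :=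
  hP.isometry_ext hn hF (hP.map_zero hn hg) rfl fun j hj =>
    hF.map_bary hP.isPolytope hj.le (hgF j hj.le)

/-- The only symmetry moving exactly the `k`-face of a flag is the fundamental reflection. -/
theorem IsRegularEdgeScribed.eq_fundRefl (hk : k < n) {g : Eucl n ≃ᵃⁱ[ℝ] Eucl n} (hg : g '' P = P)
    (hgF : ∀ j ≤ n, j ≠ k → g '' F j = F j) (hgk : g '' F k ≠ F k) : g = fundRefl F k := by
  have hg0 := hP.map_zero hn hg
  have hfix : ∀ j ≤ n, j ≠ k → g (bary (F j)) = bary (F j) := fun j hj hjk =>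
    hF.map_bary hP.isPolytope hj (hgF j hj hjk)
  refine hP.isometry_ext hn hF hg0 (hP.fundRefl_zero hn hF hk) fun j hj => ?_
  by_cases hjk : j = k
  · subst hjk
    have hν := hP.norm_wallNormal_sq_pos hF hk
    set z := g (bary (F j)) - bary (F j) with hz
    have hz0 : z ≠ 0 := fun h => hgk
      ((hF.isKFace hj.le).image_eq_of_bary g hP.isPolytope.isFinHull hg (sub_eq_zero.1 h))
    have hinv : ∀ x y, ⟪g x, g y⟫ = ⟪x, y⟫ := fun x y => by
      simpa [hg0] using inner_map_sub_map_sub g x 0 y 0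
    -- The displacement is orthogonal to the fixed barycenters, hence normal to the wall;
    -- preservation of the norm then leaves only the mirror image.
    have h1 := hP.eq_smul_wallNormal hn hF hj (x := z) fun i hi hij => by
      have := hinv (bary (F i)) (bary (F j))
      rw [hfix i hi.le hij] at this
      rw [hz, inner_sub_right, this, sub_self]
    set t := ⟪bary (F j), z⟫
    have ht0 : t ≠ 0 := by
      intro h
      rw [h, zero_smul] at h1
      exact hz0 h1
    have hgb : g (bary (F j)) = bary (F j) + t • wallNormal F j := by
      rw [← h1, hz]; abel
    have h2 := hinv (bary (F j)) (bary (F j))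
    rw [real_inner_self_eq_norm_sq, real_inner_self_eq_norm_sq, hgb, norm_add_sq_real,
      real_inner_smul_right, real_inner_comm, hP.inner_wallNormal_bary hn hF hj hj.le, if_pos rfl,
      norm_smul, mul_pow, Real.norm_eq_abs, sq_abs] at h2
    have h3 : t = -(2 / ‖wallNormal F j‖ ^ 2) := by
      have : t * (2 + t * ‖wallNormal F j‖ ^ 2) = 0 := by linarith
      have := (mul_eq_zero.1 this).resolve_left ht0
      rw [← neg_div, eq_div_iff hν.ne']
      linarith
    rw [hgb, h3, hP.fundRefl_apply hn hF hj, hP.inner_wallNormal_bary hn hF hj hj.le, if_pos rfl,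
      mul_one]
    module
  · rw [hfix j hj.le hjk, hP.fundRefl_bary hn hF hk hj.le hjk]

/-- Regularity supplies a symmetry moving only the `k`-face, and by uniqueness it is the reflection,
which is thereby seen to preserve `P`. -/
theorem IsRegularEdgeScribed.fundRefl_spec (hk : k < n) : fundRefl F k '' P = P ∧
    (∀ j ≤ n, j ≠ k → fundRefl F k '' F j = F j) ∧ fundRefl F k '' F k ≠ F k := by
  obtain ⟨g, hg, hgF, hgk⟩ := hP.isRegular.exists_symmetry hP.isPolytope hF hk
  rw [← hP.eq_fundRefl hn hF hk hg hgF hgk]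
  exact ⟨hg, hgF, hgk⟩

theorem IsRegularEdgeScribed.eq_fundRefl_image (hk : k < n) (hG : IsFlag P G)
    (hFG : FlagAdj k F G) (hj : j ≤ n) : G j = fundRefl F k '' F j := by
  obtain ⟨g, hg, hgF⟩ := hP.isRegular F G hF hG
  rw [← hgF j hj, ← hP.eq_fundRefl hn hF hk hg (fun i hi hik => by rw [hgF i hi, hFG.1 i hi hik])
    (by rw [hgF k hk.le]; exact hFG.2)]

end Normals

/-! ### An isomorphism of face lattices preserves the Schläfli symbol. -/

section Transfer

variable {m n : ℕ} {P : Set (Eucl n)} {Q : Set (Eucl m)} {F : ℕ → Set (Eucl n)}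
  {G H : ℕ → Set (Eucl m)} {k : ℕ}

/-- The symmetries of `P`. -/
def symGroup (P : Set (Eucl n)) : Subgroup (Eucl n ≃ᵃⁱ[ℝ] Eucl n) where
  carrier := {g | g '' P = P}
  one_mem' := image_id P
  mul_mem' {a b} (ha : a '' P = P) (hb : b '' P = P) := by
    show (a * b) '' P = P
    rw [AffineIsometryEquiv.coe_mul, image_comp, hb, ha]
  inv_mem' {a} (ha : a '' P = P) := by
    show (a⁻¹ : Eucl n ≃ᵃⁱ[ℝ] Eucl n) '' P = P
    conv_lhs => rw [← ha, ← image_comp, ← AffineIsometryEquiv.coe_mul, inv_mul_cancel]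
    exact image_id P

theorem mem_symGroup {g : Eucl n ≃ᵃⁱ[ℝ] Eucl n} : g ∈ symGroup P ↔ g '' P = P := Iff.rfl

/-- The extension of an isomorphism of face lattices to all sets. -/
noncomputable def faceMap {Q : Set (Eucl m)} {f : Set (Eucl n)}
    (e : {f : Set (Eucl m) // IsExposed ℝ Q f} ≃o {g : Set (Eucl n) // IsExposed ℝ f g})
    (h : Set (Eucl m)) : Set (Eucl n) :=
  open Classical in if hh : IsExposed ℝ Q h then (e ⟨h, hh⟩).1 else ∅

section FaceMap

variable {f : Set (Eucl n)}
  {e : {f : Set (Eucl m) // IsExposed ℝ Q f} ≃o {g : Set (Eucl n) // IsExposed ℝ f g}}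
  {h h' : Set (Eucl m)}

theorem faceMap_of_isExposed (hh : IsExposed ℝ Q h) : faceMap e h = (e ⟨h, hh⟩).1 := dif_pos hh

theorem isExposed_faceMap (hh : IsExposed ℝ Q h) : IsExposed ℝ f (faceMap e h) := by
  rw [faceMap_of_isExposed hh]
  exact (e ⟨h, hh⟩).2

theorem faceMap_subset_iff (hh : IsExposed ℝ Q h) (hh' : IsExposed ℝ Q h') :
    faceMap e h ⊆ faceMap e h' ↔ h ⊆ h' := by
  rw [faceMap_of_isExposed hh, faceMap_of_isExposed hh']
  exact e.le_iff_le

theorem faceMap_inj (hh : IsExposed ℝ Q h) (hh' : IsExposed ℝ Q h') :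
    faceMap e h = faceMap e h' ↔ h = h' := by
  rw [subset_antisymm_iff, faceMap_subset_iff hh hh', faceMap_subset_iff hh' hh,
    ← subset_antisymm_iff]

theorem faceMap_self : faceMap e Q = f := by
  apply (isExposed_faceMap (IsExposed.refl Q)).subset.antisymm
  obtain ⟨h, hh⟩ := e.surjective ⟨f, IsExposed.refl f⟩
  have : faceMap e h.1 = f := by rw [faceMap_of_isExposed h.2]; exact congrArg Subtype.val hh
  conv_lhs => rw [← this]
  exact (faceMap_subset_iff h.2 (IsExposed.refl Q)).2 h.2.subset

theorem faceMap_nonempty (hh : IsExposed ℝ Q h) (hne : h.Nonempty) : (faceMap e h).Nonempty := by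
  rw [nonempty_iff_ne_empty] at hne ⊢
  intro h0
  apply hne
  obtain ⟨h', hh'⟩ := e.surjective ⟨∅, isExposed_empty⟩
  have : faceMap e h'.1 = ∅ := by rw [faceMap_of_isExposed h'.2]; exact congrArg Subtype.val hh'
  have h1 : h ⊆ ∅ := by
    rw [← faceMap_subset_iff (e := e) hh isExposed_empty, h0]
    exact empty_subset _
  exact subset_empty_iff.1 h1

end FaceMap

/-- The flag of `P` that is obtained from a flag `G` of a realization of the face `F m`. -/
noncomputable def flagMap
    (e : {f : Set (Eucl m) // IsExposed ℝ Q f} ≃o {g : Set (Eucl n) // IsExposed ℝ (F m) g})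
    (G : ℕ → Set (Eucl m)) (j : ℕ) : Set (Eucl n) :=
  if j ≤ m then faceMap e (G j) else F j

variable {e : {f : Set (Eucl m) // IsExposed ℝ Q f} ≃o {g : Set (Eucl n) // IsExposed ℝ (F m) g}}

theorem flagMap_of_le {j : ℕ} (hj : j ≤ m) : flagMap e G j = faceMap e (G j) := if_pos hj

/-- A lattice isomorphism respects only inclusion, so dimensions have to be recovered: those of the
images of `G 0, …, G m` increase strictly and end with `m`, which forces them to be `0, …, m`. -/
theorem IsFlag.flagMap (hP : IsFinHull P) (hmn : m ≤ n) (hF : IsFlag P F)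
    (hG : IsFlag Q G) : IsFlag P (flagMap e G) := by
  have hex : ∀ j ≤ m, IsExposed ℝ Q (G j) := fun j hj => (hG.isKFace hj).1
  have hkf : ∀ j ≤ m, IsKFace P (Module.finrank ℝ (vectorSpan ℝ (faceMap e (G j))))
      (faceMap e (G j)) := fun j hj =>
    (hF.isKFace hmn).trans hP ⟨isExposed_faceMap (hex j hj),
      faceMap_nonempty (hex j hj) (hG.nonempty hj), rfl⟩
  have hsub : ∀ j < m, faceMap e (G j) ⊆ faceMap e (G (j + 1)) := fun j hj =>
    (faceMap_subset_iff (hex j hj.le) (hex _ hj)).2 (hG.2.1 j hj)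
  have hlt : ∀ j < m, Module.finrank ℝ (vectorSpan ℝ (faceMap e (G j))) <
      Module.finrank ℝ (vectorSpan ℝ (faceMap e (G (j + 1)))) := fun j hj =>
    (hkf j hj.le).lt_of_ne (hkf _ hj) (hsub j hj) fun he => by
      have h1 := (faceMap_inj (hex j hj.le) (hex _ hj)).1 he
      have h2 := (hG.isKFace hj.le).2.2
      have h3 := (hG.isKFace (k := j + 1) hj).2.2
      rw [h1, h3] at h2
      omega
  have htop : faceMap e (G m) = F m := by rw [hG.2.2]; exact faceMap_self
  have hge : ∀ j ≤ m, j ≤ Module.finrank ℝ (vectorSpan ℝ (faceMap e (G j))) := by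
    intro j
    induction j with
    | zero => omega
    | succ j ih =>
      intro hj
      have := ih (by omega)
      have := hlt j hj
      omega
  have hle : ∀ j ≤ m, Module.finrank ℝ (vectorSpan ℝ (faceMap e (G j))) ≤ j := by
    intro j hj
    induction hj using Nat.decreasingInduction with
    | self => rw [htop, (hF.isKFace hmn).2.2]
    | of_succ j hj ih =>
      have := hlt j hj
      omega
  have hkf' : ∀ j ≤ m, IsKFace P j (faceMap e (G j)) := fun j hj => by
    have := hkf j hj
    rwa [le_antisymm (hle j hj) (hge j hj)] at this
  refine ⟨fun j hj => ?_, fun j hj => ?_, ?_⟩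
  · rw [PolytopalDescartes.flagMap]
    split_ifs with h
    · exact hkf' j h
    · exact hF.isKFace hj
  · rw [PolytopalDescartes.flagMap, PolytopalDescartes.flagMap]
    rcases lt_trichotomy j m with h | rfl | h
    · rw [if_pos h.le, if_pos (Nat.succ_le_of_lt h)]
      exact hsub j h
    · rw [if_pos le_rfl, if_neg (by omega), htop]
      exact hF.2.1 j hj
    · rw [if_neg (by omega), if_neg (by omega)]
      exact hF.2.1 j hj
  · rw [PolytopalDescartes.flagMap]
    split_ifs with h
    · obtain rfl : n = m := le_antisymm h hmn
      rw [htop, hF.2.2]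
    · exact hF.2.2

theorem FlagAdj.flagMap (hG : IsFlag Q G) (hH : IsFlag Q H) (hk : k ≤ m) (h : FlagAdj k G H) :
    FlagAdj k (flagMap e G) (flagMap e H) := by
  refine ⟨fun j _ hjk => ?_, ?_⟩
  · rw [PolytopalDescartes.flagMap, PolytopalDescartes.flagMap]
    split_ifs with hj
    · rw [h.1 j hj hjk]
    · rfl
  · rw [flagMap_of_le hk, flagMap_of_le hk, Ne,
      faceMap_inj (hH.isKFace hk).1 (hG.isKFace hk).1]
    exact h.2

theorem IsRegularEdgeScribed.flagAdj_mul_fundRefl (hP : IsRegularEdgeScribed P) (hn : 2 ≤ n)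
    (hF : IsFlag P F) (hk : k < n) (g : Eucl n ≃ᵃⁱ[ℝ] Eucl n) :
    FlagAdj k (fun j => g '' F j) (fun j => (g * fundRefl F k) '' F j) := by
  obtain ⟨-, h2, h3⟩ := hP.fundRefl_spec hn hF hk
  refine ⟨fun j hj hjk => ?_, ?_⟩
  · simp only [AffineIsometryEquiv.coe_mul, image_comp, h2 j hj hjk]
  · simp only [AffineIsometryEquiv.coe_mul, image_comp]
    exact fun h => h3 (g.injective.image_injective h)

theorem fundRefl_congr {F G : ℕ → Set (Eucl n)} (h : ∀ j ≤ n, F j = G j) (k : ℕ) :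
    fundRefl F k = fundRefl G k := by
  have : wall F k = wall G k := by
    rw [wall, wall, h n le_rfl]
    congr 2
    ext x
    exact exists_congr fun j => and_congr_right fun hj => by rw [h j hj.le]
  ext1 x
  exact EuclideanGeometry.eq_reflection_of_eq_subspace this x

theorem IsRegularEdgeScribed.fundRefl_image (hP : IsRegularEdgeScribed P) (hn : 2 ≤ n)
    (hF : IsFlag P F) (hk : k < n) {g : Eucl n ≃ᵃⁱ[ℝ] Eucl n} (hg : g ∈ symGroup P) :
    fundRefl (fun j => g '' F j) k = g * fundRefl F k * g⁻¹ := by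
  obtain ⟨h1, h2, h3⟩ := hP.fundRefl_spec hn hF hk
  have hgF := hF.image_isometry g hg
  have hc : ∀ j, (g * fundRefl F k * g⁻¹) '' (g '' F j) = g '' (fundRefl F k '' F j) := fun j => by
    rw [← image_comp, ← image_comp, ← AffineIsometryEquiv.coe_mul, ← AffineIsometryEquiv.coe_mul]
    simp
  refine (hP.eq_fundRefl hn hgF hk ?_ ?_ ?_).symm
  · exact mem_symGroup.1 (mul_mem (mul_mem hg (mem_symGroup.2 h1)) (inv_mem hg))
  · intro j hj hjk
    simp only [hc, h2 j hj hjk]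
  · simp only [hc]
    exact fun h => h3 (g.injective.image_injective h)

/-- Multiplying by `r_k` on the right passes from the flag `g G` to its `k`-adjacent flag. `flagMap`
preserves adjacency, and in `P` the adjacent flag is the mirror image under the conjugate of the
reflection by `h`; so the same multiplication occurs on that side. -/
theorem IsRegularEdgeScribed.flagMap_step (hP : IsRegularEdgeScribed P) (hn : 2 ≤ n) (hmn : m ≤ n)
    (hF : IsFlag P F) (hQ : IsRegularEdgeScribed Q) (hm : 2 ≤ m) (hG : IsFlag Q G) (hk : k < m)
    {g : Eucl m ≃ᵃⁱ[ℝ] Eucl m} (hg : g ∈ symGroup Q) {h : Eucl n ≃ᵃⁱ[ℝ] Eucl n}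
    (hh : h ∈ symGroup P)
    (hgh : ∀ j ≤ n, flagMap e (fun i => g '' G i) j = h '' flagMap e G j) :
    ∀ j ≤ n, flagMap e (fun i => (g * fundRefl G k) '' G i) j =
      (h * fundRefl (flagMap e G) k) '' flagMap e G j := by
  intro j hj
  have hTG : IsFlag P (flagMap e G) := hF.flagMap hP.isPolytope.isFinHull hmn hG
  have hgG := hG.image_isometry g hg
  have hr := mem_symGroup.2 (hQ.fundRefl_spec hm hG hk).1
  have hgrG := hG.image_isometry _ (mem_symGroup.1 (mul_mem hg hr))
  have hadj : FlagAdj k (flagMap e fun i => g '' G i)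
      (flagMap e fun i => (g * fundRefl G k) '' G i) :=
    FlagAdj.flagMap hgG hgrG hk.le (hQ.flagAdj_mul_fundRefl hm hG hk g)
  have hTgG : IsFlag P (flagMap e fun i => g '' G i) :=
    hF.flagMap hP.isPolytope.isFinHull hmn hgG
  have hTgrG : IsFlag P (flagMap e fun i => (g * fundRefl G k) '' G i) :=
    hF.flagMap hP.isPolytope.isFinHull hmn hgrG
  have hkn : k < n := by omega
  rw [hP.eq_fundRefl_image hn hTgG hkn hTgrG hadj hj, fundRefl_congr hgh k,
    hP.fundRefl_image hn hTG hkn hh, hgh j hj, ← image_comp, ← AffineIsometryEquiv.coe_mul]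
  simp

/-- The orders of the products of consecutive fundamental reflections are determined by the face
lattice. -/
theorem IsRegularEdgeScribed.orderOf_flagMap (hP : IsRegularEdgeScribed P) (hn : 2 ≤ n)
    (hmn : m ≤ n) (hF : IsFlag P F) (hQ : IsRegularEdgeScribed Q) (hm : 2 ≤ m) (hG : IsFlag Q G)
    (hk : k + 1 < m) :
    orderOf (fundRefl G k * fundRefl G (k + 1)) =
      orderOf (fundRefl (flagMap e G) k * fundRefl (flagMap e G) (k + 1)) := by
  have hTG : IsFlag P (flagMap e G) := hF.flagMap hP.isPolytope.isFinHull hmn hG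
  have hr : ∀ i < m, fundRefl G i ∈ symGroup Q := fun i hi =>
    mem_symGroup.2 (hQ.fundRefl_spec hm hG hi).1
  have hr' : ∀ i < n, fundRefl (flagMap e G) i ∈ symGroup P := fun i hi =>
    mem_symGroup.2 (hP.fundRefl_spec hn hTG hi).1
  have hrs := mul_mem (hr k (by omega)) (hr (k + 1) (by omega))
  have hrs' := mul_mem (hr' k (by omega)) (hr' (k + 1) (by omega))
  -- Powers of the two products act on corresponding flags in the same way, and a symmetry fixing a
  -- flag is trivial; so the same powers are trivial on both sides.
  have key : ∀ N : ℕ, ∀ j ≤ n,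
      flagMap e (fun i => ((fundRefl G k * fundRefl G (k + 1)) ^ N) '' G i) j =
      ((fundRefl (flagMap e G) k * fundRefl (flagMap e G) (k + 1)) ^ N) '' flagMap e G j := by
    intro N
    induction N with
    | zero =>
      intro j hj
      simp only [pow_zero, AffineIsometryEquiv.coe_one, image_id]
    | succ N ih =>
      have h1 := hP.flagMap_step hn hmn hF hQ hm hG (k := k) (by omega) (pow_mem hrs N)
        (pow_mem hrs' N) ih
      have h2 := hP.flagMap_step hn hmn hF hQ hm hG hk
        (mul_mem (pow_mem hrs N) (hr k (by omega))) (mul_mem (pow_mem hrs' N) (hr' k (by omega))) h1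
      simpa only [pow_succ, mul_assoc] using h2
  rw [orderOf_eq_orderOf_iff]
  intro N
  constructor
  · intro h
    refine hP.eq_one_of_image_eq hn hTG (pow_mem hrs' N) fun j hj => ?_
    rw [← key N j hj, h]
    simp only [AffineIsometryEquiv.coe_one, image_id]
  · intro h
    refine hQ.eq_one_of_image_eq hm hG (pow_mem hrs N) fun j hj => ?_
    have h1 := key N j (by omega)
    rw [h, AffineIsometryEquiv.coe_one, image_id, flagMap_of_le hj, flagMap_of_le hj,
      faceMap_inj ((hG.image_isometry _ (mem_symGroup.1 (pow_mem hrs N))).isKFace hj).1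
      (hG.isKFace hj).1] at h1
    exact h1

theorem IsRegularEdgeScribed.hasSchlafliSymbol_of_combEquiv (hP : IsRegularEdgeScribed P)
    (hmn : m ≤ n) (hm : 2 ≤ m) (hF : IsFlag P F) (hQ : IsRegularEdgeScribed Q) {p : ℕ → ℕ}
    (hp : HasSchlafliSymbol P p) (he : CombEquiv Q (F m)) : HasSchlafliSymbol Q p := by
  obtain ⟨e⟩ := he
  intro G hG k hk
  rw [hP.orderOf_flagMap (e := e) (hm.trans hmn) hmn hF hQ hm hG hk]
  exact hp _ (hF.flagMap hP.isPolytope.isFinHull hmn hG) k (by omega)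

end Transfer

/-! ### Reflections of a plane in complex coordinates. -/

section Dihedral

variable {E : Type*} [NormedAddCommGroup E] [InnerProductSpace ℝ E]

/-- The complex coordinate on the plane spanned by `e` and `v`. -/
noncomputable def planeMap (e v : E) (z : ℂ) : E := z.re • e + z.im • v

variable {e v : E}

theorem inner_planeMap (hee : ⟪e, e⟫ = 1) (hvv : ⟪v, v⟫ = 1) (hev : ⟪e, v⟫ = 0) (a b : ℝ) (z : ℂ) :
    ⟪a • e + b • v, planeMap e v z⟫ = a * z.re + b * z.im := by
  simp only [planeMap, inner_add_left, inner_add_right, real_inner_smul_left,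
    real_inner_smul_right, hee, hvv, hev, real_inner_comm e v]
  ring

theorem planeMap_conj (z : ℂ) :
    planeMap e v z - (2 * z.im) • v = planeMap e v (starRingEnd ℂ z) := by
  simp only [planeMap, Complex.conj_re, Complex.conj_im]
  module

/-- The mirror is the line at angle `θ`, so the reflection is `z ↦ e^{2iθ} z̄`; `planeMap_conj` is
the case of the real axis. Their product is the rotation by `2θ`. -/
theorem planeMap_rotation (θ : ℝ) (z : ℂ) :
    planeMap e v z - (2 * (Real.sin θ * z.re - Real.cos θ * z.im)) •
      (Real.sin θ • e - Real.cos θ • v) =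
    planeMap e v (Complex.exp ((2 * θ : ℝ) * Complex.I) * starRingEnd ℂ z) := by
  have hre : (Complex.exp ((2 * θ : ℝ) * Complex.I) * starRingEnd ℂ z).re =
      (1 - 2 * Real.sin θ ^ 2) * z.re + 2 * Real.sin θ * Real.cos θ * z.im := by
    rw [Complex.mul_re, Complex.exp_ofReal_mul_I_re, Complex.exp_ofReal_mul_I_im, Complex.conj_re,
      Complex.conj_im, Real.cos_two_mul, Real.sin_two_mul, Real.cos_sq']
    ring
  have him : (Complex.exp ((2 * θ : ℝ) * Complex.I) * starRingEnd ℂ z).im =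
      (1 - 2 * Real.cos θ ^ 2) * z.im + 2 * Real.sin θ * Real.cos θ * z.re := by
    rw [Complex.mul_im, Complex.exp_ofReal_mul_I_re, Complex.exp_ofReal_mul_I_im, Complex.conj_re,
      Complex.conj_im, Real.cos_two_mul, Real.sin_two_mul]
    ring
  rw [planeMap, planeMap, hre, him]
  module

theorem planeMap_injective (hee : ⟪e, e⟫ = 1) (hvv : ⟪v, v⟫ = 1) (hev : ⟪e, v⟫ = 0) :
    Function.Injective (planeMap e v) := by
  intro z w h
  have h1 := inner_planeMap hee hvv hev 1 0 z
  have h2 := inner_planeMap hee hvv hev 0 1 z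
  rw [h, inner_planeMap hee hvv hev] at h1 h2
  apply Complex.ext <;> linarith

end Dihedral

/-! ### The dihedral angles of the chamber. -/

section Chamber

variable {n : ℕ} {P : Set (Eucl n)} {F : ℕ → Set (Eucl n)} {k : ℕ}

theorem IsFinHull.finite_faces (hP : IsFinHull P) : {f | IsExposed ℝ P f}.Finite := by
  refine (hP.finite_extremePoints.finite_subsets.image (convexHull ℝ)).subset fun f hf => ?_
  exact ⟨f.extremePoints ℝ, hf.isExtreme.extremePoints_subset_extremePoints,
    (hP.of_isExposed hf).convexHull_extremePoints⟩

/-- A symmetry is determined by the images of the faces of one flag, and there are finitely many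
faces. -/
theorem IsRegularEdgeScribed.finite_symGroup (hP : IsRegularEdgeScribed P) (hn : 2 ≤ n) :
    (symGroup P : Set (Eucl n ≃ᵃⁱ[ℝ] Eucl n)).Finite := by
  obtain ⟨F, hF⟩ := hP.isPolytope.exists_flag
  have hfin : (Set.pi univ fun _ : Fin n => {f | IsExposed ℝ P f}).Finite :=
    Set.Finite.pi fun _ => hP.isPolytope.isFinHull.finite_faces
  refine Set.Finite.of_finite_image (f := fun g => fun j : Fin n => g '' F j)
    (hfin.subset ?_) ?_
  · rintro _ ⟨g, hg, rfl⟩ j -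
    exact ((hF.isKFace j.2.le).image_isometry g hg).1
  · intro g hg h hh hgh
    refine hP.isometry_ext hn hF (hP.map_zero hn hg) (hP.map_zero hn hh) fun j hj => ?_
    have : g '' F j = h '' F j := congrFun hgh ⟨j, hj⟩
    rw [← hF.bary_image hP.isPolytope hj.le, this, hF.bary_image hP.isPolytope hj.le]

theorem IsRegularEdgeScribed.orderOf_pos (hP : IsRegularEdgeScribed P) (hn : 2 ≤ n)
    {g : Eucl n ≃ᵃⁱ[ℝ] Eucl n} (hg : g ∈ symGroup P) : 0 < orderOf g := by
  rw [orderOf_pos_iff]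
  by_contra h
  rw [← injective_pow_iff_not_isOfFinOrder] at h
  exact (Set.infinite_range_of_injective h) ((hP.finite_symGroup hn).subset
    (range_subset_iff.2 fun N => pow_mem hg N))

/-- A symmetry fixing all but two consecutive barycenters of a flag, and a point strictly inside
the corresponding dihedral angle of the chamber, is trivial. -/
theorem IsRegularEdgeScribed.eq_one_of_fixed_point (hP : IsRegularEdgeScribed P) (hn : 2 ≤ n)
    (hF : IsFlag P F) (hk : k + 1 < n) {g : Eucl n ≃ᵃⁱ[ℝ] Eucl n} (hg : g ∈ symGroup P)
    (hfix : ∀ j < n, j ≠ k → j ≠ k + 1 → g (bary (F j)) = bary (F j)) {x : Eucl n} (hx : g x = x)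
    (h1 : 0 < ⟪wallNormal F k, x⟫) (h2 : 0 < ⟪wallNormal F (k + 1), x⟫) : g = 1 := by
  have hg0 := hP.map_zero hn hg
  set μ := ⟪wallNormal F k, x⟫
  set ν := ⟪wallNormal F (k + 1), x⟫
  have hsum : ∀ y : ℕ → Eucl n, (∀ j < n, j ≠ k → j ≠ k + 1 → y j = bary (F j)) →
      ∑ j ∈ Finset.range n, ⟪wallNormal F j, x⟫ • y j =
      (∑ j ∈ (Finset.range n).filter (fun j => j ≠ k ∧ j ≠ k + 1),
        ⟪wallNormal F j, x⟫ • bary (F j)) + (μ • y k + ν • y (k + 1)) := by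
    intro y hy
    rw [← Finset.sum_filter_add_sum_filter_not (Finset.range n) (fun j => j ≠ k ∧ j ≠ k + 1)]
    congr 1
    · refine Finset.sum_congr rfl fun j hj => ?_
      rw [Finset.mem_filter, Finset.mem_range] at hj
      rw [hy j hj.1 hj.2.1 hj.2.2]
    · have : (Finset.range n).filter (fun j => ¬ (j ≠ k ∧ j ≠ k + 1)) = {k, k + 1} := by
        ext j
        simp only [Finset.mem_filter, Finset.mem_range, Finset.mem_insert, Finset.mem_singleton]
        omega
      rw [this, Finset.sum_pair (by omega)]
  -- The two expansions of `g x = x` in the barycenters, with the fixed terms cancelled.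
  have heq : μ • g (bary (F k)) + ν • g (bary (F (k + 1))) =
      μ • bary (F k) + ν • bary (F (k + 1)) := by
    have e1 := hP.map_eq_sum hn hF hg0 x
    rw [hsum (fun j => g (bary (F j))) hfix, hx] at e1
    have e2 := hP.eq_sum_bary hn hF x
    rw [hsum (fun j => bary (F j)) (fun _ _ _ _ => rfl)] at e2
    exact add_left_cancel (e1.symm.trans e2)
  have hμν : 0 < μ + ν := by positivity
  have hconv : ∀ a b : Eucl n, (μ + ν)⁻¹ • (μ • a + ν • b) ∈ openSegment ℝ a b := fun a b =>
    ⟨(μ + ν)⁻¹ * μ, (μ + ν)⁻¹ * ν, by positivity, by positivity,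
      by rw [← mul_add, inv_mul_cancel₀ hμν.ne'], by module⟩
  have hbk := hF.bary_mem_of_le hP.isPolytope (Nat.le_succ k) hk.le
  have hbk1 := hF.bary_mem hP.isPolytope hk.le
  have hgface := (hF.isKFace hk.le).image_isometry g hg
  have hy1 : (μ + ν)⁻¹ • (μ • bary (F k) + ν • bary (F (k + 1))) ∈ g '' F (k + 1) := by
    rw [← heq]
    exact (hgface.isFinHull hP.isPolytope.isFinHull).convex.openSegment_subset
      (mem_image_of_mem g hbk) (mem_image_of_mem g hbk1) (hconv _ _)
  -- The face `g '' F (k + 1)` contains an interior point of the segment from `bary (F k)` to `bary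
  -- (F (k + 1))`, hence its ends. So `g` preserves `F (k + 1)` and fixes its barycenter, and `heq`
  -- then gives the same for `bary (F k)`.
  have hb1 : bary (F (k + 1)) ∈ g '' F (k + 1) :=
    hgface.1.isExtreme.right_mem_of_mem_openSegment ((hF.isKFace hk.le).subset hbk)
      ((hF.isKFace hk.le).subset hbk1) hy1 (hconv _ _)
  have hgF : g '' F (k + 1) = F (k + 1) :=
    ((hF.isKFace hk.le).eq_of_subset hgface
      (((hF.isFinHull hP.isPolytope.isFinHull hk.le)).subset_of_bary_mem (hF.nonempty hk.le)
        hP.isPolytope.isFinHull (hF.isKFace hk.le).subset hgface.1 hb1)).symm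
  have hg1 := hF.map_bary hP.isPolytope hk.le hgF
  rw [hg1, add_left_inj] at heq
  have hgk := smul_right_injective (Eucl n) h1.ne' heq
  refine hP.isometry_ext hn hF hg0 rfl fun j hj => ?_
  by_cases hjk : j = k
  · rw [hjk]; exact hgk
  · by_cases hjk1 : j = k + 1
    · rw [hjk1]; exact hg1
    · exact hfix j hj hjk hjk1

/-- The dihedral angle of the chamber at consecutive walls is `π / p`, where `p` is the order of the
product of the two reflections. -/
theorem IsRegularEdgeScribed.sq_stepCovec_eq (hP : IsRegularEdgeScribed P) (hn : 2 ≤ n)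
    (hF : IsFlag P F) (hk : k + 1 < n) :
    (‖stepCovec F (k + 1)‖ ^ 2) ^ 2 =
      Real.cos (Real.pi / orderOf (fundRefl F k * fundRefl F (k + 1))) ^ 2 *
        ((‖stepCovec F k‖ ^ 2 + ‖stepCovec F (k + 1)‖ ^ 2) *
          (‖stepCovec F (k + 1)‖ ^ 2 + ‖stepCovec F (k + 1 + 1)‖ ^ 2)) := by
  have hk0 : k < n := by omega
  have hA2 := hP.norm_wallNormal_sq_pos hF hk0
  have hB2 := hP.norm_wallNormal_sq_pos hF hk
  have hq1 : 0 < ‖stepCovec F (k + 1)‖ ^ 2 := by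
    rw [hP.norm_stepCovec_sq hF hk0]
    exact inv_pos.2 (hP.norm_step_sq_pos hF hk0)
  have hq2 : 0 < ‖stepCovec F (k + 1 + 1)‖ ^ 2 := by
    rw [hP.norm_stepCovec_sq hF hk]
    exact inv_pos.2 (hP.norm_step_sq_pos hF hk)
  rw [← hP.norm_wallNormal_sq hF hk0, ← hP.norm_wallNormal_sq hF hk]
  set A := ‖wallNormal F k‖ with hA
  set B := ‖wallNormal F (k + 1)‖ with hB
  have hA0 : 0 < A := by
    rcases (norm_nonneg (wallNormal F k)).lt_or_eq with h | h
    · exact h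
    · rw [← hA] at h; rw [← h] at hA2; norm_num at hA2
  have hB0 : 0 < B := by
    rcases (norm_nonneg (wallNormal F (k + 1))).lt_or_eq with h | h
    · exact h
    · rw [← hB] at h; rw [← h] at hB2; norm_num at hB2
  set q := ‖stepCovec F (k + 1)‖ ^ 2 with hq
  -- Minus the cosine of the angle between the two normals, so `θ` below is the angle of the chamber
  -- between the two walls.
  set c := q / (A * B) with hc
  have hc0 : 0 < c := by positivity
  have hc2 : c ^ 2 < 1 := by
    rw [hc, div_pow, div_lt_one (by positivity), mul_pow, hA, hB, hP.norm_wallNormal_sq hF hk0,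
      hP.norm_wallNormal_sq hF hk, ← hq]
    have : 0 ≤ ‖stepCovec F k‖ ^ 2 := by positivity
    nlinarith
  have hc1 : c < 1 := by nlinarith
  set θ := Real.arccos c with hθ
  have hcos : Real.cos θ = c := Real.cos_arccos (by linarith) hc1.le
  have hθ0 : 0 < θ := Real.arccos_pos.2 hc1
  have hθ1 : θ < Real.pi / 2 := Real.arccos_lt_pi_div_two.2 hc0
  have hsin : 0 < Real.sin θ := Real.sin_pos_of_pos_of_lt_pi hθ0 (by linarith [Real.pi_pos])
  -- orthonormal frame of the plane spanned by the two normals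
  obtain ⟨u, hu⟩ : ∃ u : Eucl n, u = A⁻¹ • wallNormal F k := ⟨_, rfl⟩
  obtain ⟨v, hv⟩ : ∃ v : Eucl n, v = B⁻¹ • wallNormal F (k + 1) := ⟨_, rfl⟩
  have huu : ⟪u, u⟫ = 1 := by
    rw [hu, real_inner_smul_left, real_inner_smul_right, real_inner_self_eq_norm_sq, ← hA]
    field_simp
  have hvv : ⟪v, v⟫ = 1 := by
    rw [hv, real_inner_smul_left, real_inner_smul_right, real_inner_self_eq_norm_sq, ← hB]
    field_simp
  have huv : ⟪u, v⟫ = -Real.cos θ := by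
    rw [hcos, hu, hv, real_inner_smul_left, real_inner_smul_right, hP.inner_wallNormal_succ hF hk,
      ← hq, hc]
    field_simp
  obtain ⟨e, he⟩ : ∃ e : Eucl n, e = (Real.sin θ)⁻¹ • (u + Real.cos θ • v) := ⟨_, rfl⟩
  have hue : u = Real.sin θ • e - Real.cos θ • v := by
    rw [he, smul_smul, mul_inv_cancel₀ hsin.ne']
    module
  have hev : ⟪e, v⟫ = 0 := by
    rw [he, real_inner_smul_left, inner_add_left, real_inner_smul_left, huv, hvv]
    ring
  have hee : ⟪e, e⟫ = 1 := by
    rw [he, real_inner_smul_left, real_inner_smul_right, inner_add_left, inner_add_right,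
      inner_add_right, real_inner_smul_left, real_inner_smul_left, real_inner_smul_right,
      real_inner_smul_right, huu, hvv, real_inner_comm u v, huv]
    field_simp
    nlinarith [Real.sin_sq_add_cos_sq θ]
  have hru : ∀ x, fundRefl F k x = x - (2 * ⟪u, x⟫) • u := fun x => by
    rw [hP.fundRefl_apply hn hF hk0, hu, real_inner_smul_left, smul_smul, ← hA]
    congr 2
    field_simp
  have hrv : ∀ x, fundRefl F (k + 1) x = x - (2 * ⟪v, x⟫) • v := fun x => by
    rw [hP.fundRefl_apply hn hF hk, hv, real_inner_smul_left, smul_smul, ← hB]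
    congr 2
    field_simp
  have hiu : ∀ z, ⟪u, planeMap e v z⟫ = Real.sin θ * z.re - Real.cos θ * z.im := fun z => by
    rw [hue, sub_eq_add_neg, ← neg_smul, inner_planeMap hee hvv hev]
    ring
  have hiv : ∀ z, ⟪v, planeMap e v z⟫ = z.im := fun z => by
    have := inner_planeMap hee hvv hev 0 1 z
    simpa using this
  set ζ := Complex.exp ((2 * θ : ℝ) * Complex.I) with hζ
  have hr1 : ∀ z, fundRefl F k (planeMap e v z) = planeMap e v (ζ * starRingEnd ℂ z) := fun z => by
    rw [hru, hiu, hζ, ← planeMap_rotation, ← hue]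
  have hr2 : ∀ z, fundRefl F (k + 1) (planeMap e v z) = planeMap e v (starRingEnd ℂ z) := fun z => by
    rw [hrv, hiv, planeMap_conj]
  set ρ := fundRefl F k * fundRefl F (k + 1) with hρ
  have hρz : ∀ (N : ℕ) z, (ρ ^ N) (planeMap e v z) = planeMap e v (ζ ^ N * z) := by
    intro N
    induction N with
    | zero => intro z; simp
    | succ N ih =>
      intro z
      rw [pow_succ, AffineIsometryEquiv.coe_mul, Function.comp_apply, hρ,
        AffineIsometryEquiv.coe_mul, Function.comp_apply, hr2, hr1, Complex.conj_conj, ← hρ, ih,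
        pow_succ, mul_assoc]
  have hs1 : fundRefl F k ∈ symGroup P := mem_symGroup.2 (hP.fundRefl_spec hn hF hk0).1
  have hs2 : fundRefl F (k + 1) ∈ symGroup P := mem_symGroup.2 (hP.fundRefl_spec hn hF hk).1
  have hρs : ρ ∈ symGroup P := mul_mem hs1 hs2
  have hρfix : ∀ N : ℕ, ∀ j < n, j ≠ k → j ≠ k + 1 → (ρ ^ N) (bary (F j)) = bary (F j) := by
    intro N j hj h1 h2
    induction N with
    | zero => simp
    | succ N ih =>
      rw [pow_succ, AffineIsometryEquiv.coe_mul, Function.comp_apply, hρ,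
        AffineIsometryEquiv.coe_mul, Function.comp_apply, hP.fundRefl_bary hn hF hk hj.le h2,
        hP.fundRefl_bary hn hF hk0 hj.le h1, ← hρ, ih]
  -- points strictly inside the angle
  have hin : ∀ φ : ℝ, 0 < φ → φ < θ → ∀ g ∈ symGroup P,
      (∀ j < n, j ≠ k → j ≠ k + 1 → g (bary (F j)) = bary (F j)) →
      g (planeMap e v (Complex.exp (φ * Complex.I))) = planeMap e v (Complex.exp (φ * Complex.I)) →
      g = 1 := by
    intro φ h0 h1 g hg hfix hgx
    refine hP.eq_one_of_fixed_point hn hF hk hg hfix hgx ?_ ?_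
    · have h := hiu (Complex.exp (φ * Complex.I))
      rw [Complex.exp_ofReal_mul_I_re, Complex.exp_ofReal_mul_I_im, ← Real.sin_sub, hu,
        real_inner_smul_left] at h
      have h2 : 0 < Real.sin (θ - φ) :=
        Real.sin_pos_of_pos_of_lt_pi (by linarith) (by linarith [Real.pi_pos])
      rw [← h] at h2
      exact pos_of_mul_pos_right h2 (inv_pos.2 hA0).le
    · have h := hiv (Complex.exp (φ * Complex.I))
      have h' : ∀ x, ⟪v, x⟫ = B⁻¹ * ⟪wallNormal F (k + 1), x⟫ := fun x => by
        rw [hv, real_inner_smul_left]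
      rw [Complex.exp_ofReal_mul_I_im, h'] at h
      have h2 : 0 < Real.sin φ :=
        Real.sin_pos_of_pos_of_lt_pi h0 (by linarith [Real.pi_pos])
      rw [← h] at h2
      exact pos_of_mul_pos_right h2 (inv_pos.2 hB0).le
  set p := orderOf ρ with hp
  have hp0 : 0 < p := hP.orderOf_pos hn hρs
  have hp0' : (0 : ℝ) < p := Nat.cast_pos.2 hp0
  -- If `ζ ^ N = 1`, then `ρ ^ N` fixes the plane, in particular a point on the bisector of the
  -- angle, and is trivial by `hin`. Hence `ζ` has the same order as `ρ`.
  have hpow1 : ∀ N : ℕ, ζ ^ N = 1 ↔ ρ ^ N = 1 := by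
    intro N
    constructor
    · intro h
      refine hin (θ / 2) (by linarith) (by linarith) _ (pow_mem hρs N) (hρfix N) ?_
      rw [hρz, h, one_mul]
    · intro h
      have := hρz N 1
      rw [h, AffineIsometryEquiv.coe_one, id, mul_one] at this
      exact (planeMap_injective hee hvv hev this).symm
  have hprim : IsPrimitiveRoot ζ p :=
    ⟨(hpow1 p).2 (pow_orderOf_eq_one ρ), fun l hl => orderOf_dvd_of_pow_eq_one ((hpow1 l).1 hl)⟩
  -- If `π / p < θ`, then `e^{2iπ/p}`, a `p`-th root of unity, is some `ζ ^ j`, and `ρ ^ j r_{k+1}`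
  -- reflects the plane in the ray at angle `π / p`, strictly inside the chamber. Fixing that ray,
  -- it is trivial, yet it negates the perpendicular direction. Conversely `ζ ^ p = 1` makes `p θ` a
  -- positive multiple of `π`.
  have hθeq : θ = Real.pi / p := by
    apply le_antisymm
    · by_contra! hlt
      have hφ0 : 0 < Real.pi / p := div_pos Real.pi_pos hp0'
      set φ := Real.pi / p with hφ
      have hω : (Complex.exp ((2 * φ : ℝ) * Complex.I)) ^ p = 1 := by
        rw [← Complex.exp_nat_mul, Complex.exp_eq_one_iff]
        refine ⟨1, ?_⟩
        have : (p : ℂ) ≠ 0 := Nat.cast_ne_zero.2 hp0.ne'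
        rw [hφ]
        push_cast
        field_simp
      have : NeZero p := ⟨hp0.ne'⟩
      obtain ⟨j, -, hj⟩ := hprim.eq_pow_of_pow_eq_one hω
      have hgz : ∀ z, (ρ ^ j * fundRefl F (k + 1)) (planeMap e v z) =
          planeMap e v (Complex.exp ((2 * φ : ℝ) * Complex.I) * starRingEnd ℂ z) := fun z => by
        rw [AffineIsometryEquiv.coe_mul, Function.comp_apply, hr2, hρz, hj]
      have hconj : starRingEnd ℂ (Complex.exp (φ * Complex.I)) = Complex.exp (-φ * Complex.I) := by
        rw [← Complex.exp_conj]
        simp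
      have hmul : Complex.exp ((2 * φ : ℝ) * Complex.I) * Complex.exp (-φ * Complex.I) =
          Complex.exp (φ * Complex.I) := by
        rw [← Complex.exp_add]
        congr 1
        push_cast
        ring
      have h1 : ρ ^ j * fundRefl F (k + 1) = 1 := by
        refine hin φ hφ0 hlt _ (mul_mem (pow_mem hρs j) hs2) ?_ ?_
        · intro i hi h1 h2
          rw [AffineIsometryEquiv.coe_mul, Function.comp_apply, hP.fundRefl_bary hn hF hk hi.le h2,
            hρfix j i hi h1 h2]
        · rw [hgz, hconj, hmul]
      have h2 := hgz (Complex.I * Complex.exp (φ * Complex.I))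
      rw [h1, AffineIsometryEquiv.coe_one, id, map_mul, hconj, Complex.conj_I] at h2
      have h3 := planeMap_injective hee hvv hev h2
      rw [mul_left_comm, hmul, neg_mul, ← add_eq_zero_iff_eq_neg, ← two_mul] at h3
      simp [Complex.exp_ne_zero] at h3
    · have h := hprim.pow_eq_one
      rw [hζ, ← Complex.exp_nat_mul, Complex.exp_eq_one_iff] at h
      obtain ⟨m, hm⟩ := h
      have hm' : (p : ℝ) * (2 * θ) = m * (2 * Real.pi) := by
        have h2 : ((p : ℂ) * (2 * θ)) * Complex.I = (m * (2 * Real.pi)) * Complex.I := by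
          push_cast at hm
          linear_combination hm
        have h3 := mul_right_cancel₀ Complex.I_ne_zero h2
        exact_mod_cast h3
      have hm0 : (0 : ℝ) < m := by
        have : 0 < (m : ℝ) * (2 * Real.pi) := by rw [← hm']; positivity
        exact pos_of_mul_pos_left this (by linarith [Real.pi_pos])
      have hm1 : (1 : ℝ) ≤ m := by
        have : (0 : ℤ) < m := by exact_mod_cast hm0
        exact_mod_cast this
      rw [div_le_iff₀ hp0']
      nlinarith [Real.pi_pos]
  rw [← hθeq, hcos, hc]
  field_simp

end Chamber

/-! ### The Schläfli symbol determines the edge length. -/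

section Rigidity

variable {n : ℕ} {P Q : Set (Eucl n)} {F G : ℕ → Set (Eucl n)} {i j k : ℕ}

theorem IsRegularEdgeScribed.inner_step_bary (hP : IsRegularEdgeScribed P) (hn : 2 ≤ n)
    (hF : IsFlag P F) (hi : i < n) (hj : j ≤ n) :
    ⟪bary (F (i + 1)) - bary (F i), bary (F j)⟫ =
      if j ≤ i then -‖bary (F (i + 1)) - bary (F i)‖ ^ 2 else 0 := by
  induction hj using Nat.decreasingInduction with
  | self => rw [hP.bary_last hF hn, inner_zero_right, if_neg (by omega)]
  | of_succ j hj ih =>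
    have h := hP.inner_step hF hi hj
    rw [inner_sub_right, ih] at h
    split_ifs at h ⊢ <;> first | omega | linarith

theorem IsRegularEdgeScribed.norm_bary_sq_sub (hP : IsRegularEdgeScribed P) (hn : 2 ≤ n)
    (hF : IsFlag P F) (hi : i < n) :
    ‖bary (F i)‖ ^ 2 - ‖bary (F (i + 1))‖ ^ 2 = ‖bary (F (i + 1)) - bary (F i)‖ ^ 2 := by
  have h := hP.inner_step_bary hn hF hi (j := i + 1) hi
  rw [if_neg (by omega)] at h
  have e : bary (F i) = bary (F (i + 1)) - (bary (F (i + 1)) - bary (F i)) := by abel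
  have h2 : ‖bary (F i)‖ ^ 2 = ‖bary (F (i + 1)) - (bary (F (i + 1)) - bary (F i))‖ ^ 2 := by
    rw [← e]
  rw [norm_sub_sq_real (bary (F (i + 1))) (bary (F (i + 1)) - bary (F i)), real_inner_comm, h] at h2
  linarith

theorem IsRegularEdgeScribed.norm_stepCovec_sq_pos (hP : IsRegularEdgeScribed P)
    (hF : IsFlag P F) (hk : k < n) : 0 < ‖stepCovec F (k + 1)‖ ^ 2 := by
  rw [hP.norm_stepCovec_sq hF hk]
  exact inv_pos.2 (hP.norm_step_sq_pos hF hk)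

/-- Parseval for the unit vector `bary (F 1)`, which is minus the sum of all steps but the first.
This normalization fixes the scale left free by the angles. -/
theorem IsRegularEdgeScribed.sum_inv_stepCovec (hP : IsRegularEdgeScribed P) (hn : 2 ≤ n)
    (hF : IsFlag P F) :
    ∑ i ∈ Finset.range n, (if 1 ≤ i then (‖stepCovec F (i + 1)‖ ^ 2)⁻¹ else 0) = 1 := by
  have h := sum_inner_sq_div_eq (d := fun i => bary (F (i + 1)) - bary (F i))
    (fun i hi => hF.bary_ne hP.isPolytope hi)
    (hP.isRegular.inner_bary_diff hP.isPolytope hF) (bary (F 1))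
  rw [(hP.norm_bary_zero_sq hF hn).2, one_pow] at h
  rw [← h]
  refine Finset.sum_congr rfl fun i hi => ?_
  have hi' := Finset.mem_range.1 hi
  have hpos := hP.norm_step_sq_pos hF hi'
  rw [hP.inner_step_bary hn hF hi' (by omega), hP.norm_stepCovec_sq hF hi', inv_inv]
  split_ifs
  · field_simp
  · simp

/-- The Schläfli symbol determines the half edge-length. -/
theorem IsRegularEdgeScribed.norm_edge_eq_of_symbol (hP : IsRegularEdgeScribed P)
    (hQ : IsRegularEdgeScribed Q) (hn : 2 ≤ n) {p : ℕ → ℕ} (hp : HasSchlafliSymbol P p)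
    (hq : HasSchlafliSymbol Q p) (hF : IsFlag P F) (hG : IsFlag Q G) :
    ‖bary (F 1) - bary (F 0)‖ = ‖bary (G 1) - bary (G 0)‖ := by
  have hF1 := hP.norm_stepCovec_sq_pos hF (k := 0) (by omega)
  have hG1 := hQ.norm_stepCovec_sq_pos hG (k := 0) (by omega)
  obtain ⟨c, hc⟩ : ∃ c, c = ‖stepCovec G 1‖ ^ 2 / ‖stepCovec F 1‖ ^ 2 := ⟨_, rfl⟩
  have hc0 : 0 < c := hc ▸ div_pos hG1 hF1
  have hc1 : ‖stepCovec G 1‖ ^ 2 = c * ‖stepCovec F 1‖ ^ 2 := by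
    rw [hc, div_mul_cancel₀ _ hF1.ne']
  -- The angle relation is homogeneous and involves three consecutive terms; the term of index `0`
  -- vanishes, so the first ratio `c` propagates to all indices.
  have key : ∀ k, (k ≤ n → ‖stepCovec G k‖ ^ 2 = c * ‖stepCovec F k‖ ^ 2) ∧
      (k + 1 ≤ n → ‖stepCovec G (k + 1)‖ ^ 2 = c * ‖stepCovec F (k + 1)‖ ^ 2) := by
    intro k
    induction k with
    | zero => exact ⟨fun _ => by simp [stepCovec], fun _ => hc1⟩
    | succ k ih =>
      refine ⟨ih.2, fun hk => ?_⟩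
      have e0 := ih.1 (by omega)
      have e1 := ih.2 (by omega)
      have h1 := hP.sq_stepCovec_eq hn hF (k := k) hk
      have h2 := hQ.sq_stepCovec_eq hn hG (k := k) hk
      rw [hp F hF k hk] at h1
      rw [hq G hG k hk, e0, e1] at h2
      have hpos := hP.norm_stepCovec_sq_pos hF (k := k) (by omega)
      set C := Real.cos (Real.pi / p (k + 1)) ^ 2
      set x := ‖stepCovec F k‖ ^ 2
      set y := ‖stepCovec F (k + 1)‖ ^ 2
      set z := ‖stepCovec F (k + 1 + 1)‖ ^ 2
      set w := ‖stepCovec G (k + 1 + 1)‖ ^ 2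
      -- The relation `y ^ 2 = C (x + y) (y + z)` with `y > 0` can thus be solved for `z`.
      have hne : C * (x + y) ≠ 0 := by
        intro h
        have : y ^ 2 = 0 := by rw [h1, ← mul_assoc, h, zero_mul]
        exact hpos.ne' (pow_eq_zero_iff two_ne_zero |>.1 this)
      apply mul_left_cancel₀ (mul_ne_zero hc0.ne' hne)
      have h3 : (c * y) ^ 2 = c ^ 2 * (C * ((x + y) * (y + z))) := by rw [mul_pow, h1]
      rw [h3] at h2
      linear_combination -h2
  have hsF := hP.sum_inv_stepCovec hn hF
  have hsG := hQ.sum_inv_stepCovec hn hG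
  have hsum : ∑ i ∈ Finset.range n, (if 1 ≤ i then (‖stepCovec G (i + 1)‖ ^ 2)⁻¹ else 0) =
      c⁻¹ * ∑ i ∈ Finset.range n, (if 1 ≤ i then (‖stepCovec F (i + 1)‖ ^ 2)⁻¹ else 0) := by
    rw [Finset.mul_sum]
    refine Finset.sum_congr rfl fun i hi => ?_
    rw [(key i).2 (Finset.mem_range.1 hi)]
    split_ifs
    · rw [mul_inv]
    · rw [mul_zero]
  rw [hsF, hsG, mul_one] at hsum
  have hc2 : c = 1 := by rw [← inv_inv c, ← hsum, inv_one]
  rw [hc2, one_mul, hQ.norm_stepCovec_sq hG (k := 0) (by omega),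
    hP.norm_stepCovec_sq hF (k := 0) (by omega), inv_inj] at hc1
  exact ((pow_left_inj₀ (norm_nonneg _) (norm_nonneg _) two_ne_zero).1 hc1).symm

end Rigidity

/-! ### Faces rescaled to regular edge-scribed polytopes of lower dimension. -/

section Realization

variable {m n : ℕ} {P : Set (Eucl n)} {F : ℕ → Set (Eucl n)}

/-- The similarity `x ↦ s ι(x) + c`. -/
noncomputable def similarityMap (ι : Eucl m →ₗᵢ[ℝ] Eucl n) (s : ℝ) (c : Eucl n) :
    Eucl m →ᵃ[ℝ] Eucl n where
  toFun x := s • ι x + c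
  linear := s • ι.toLinearMap
  map_vadd' x v := by
    simp only [vadd_eq_add, map_add, smul_add, LinearMap.smul_apply, LinearIsometry.coe_toLinearMap]
    abel

variable {ι : Eucl m →ₗᵢ[ℝ] Eucl n} {s : ℝ} {c : Eucl n}

theorem similarityMap_apply (x : Eucl m) : similarityMap ι s c x = s • ι x + c := rfl

theorem similarityMap_injective (hs : s ≠ 0) : Function.Injective (similarityMap ι s c) := by
  intro x y h
  rw [similarityMap_apply, similarityMap_apply, add_left_inj] at h
  exact ι.injective (smul_right_injective _ hs h)

/-- The isomorphism of face lattices induced by an injective affine map. -/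
def imageFaceIso (φ : Eucl m →ᵃ[ℝ] Eucl n) (hφ : Function.Injective φ) (Q : Set (Eucl m))
    {f : Set (Eucl n)} (hf : φ '' Q = f) :
    {h : Set (Eucl m) // IsExposed ℝ Q h} ≃o {g : Set (Eucl n) // IsExposed ℝ f g} where
  toFun h := ⟨φ '' h.1, by rw [← hf]; exact (isExposed_image φ hφ).2 h.2⟩
  invFun g := ⟨φ ⁻¹' g.1, by
    rw [← isExposed_image φ hφ, hf, image_preimage_eq_of_subset]
    · exact g.2
    · exact g.2.subset.trans (hf ▸ image_subset_range φ Q)⟩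
  left_inv h := Subtype.ext (preimage_image_eq _ hφ)
  right_inv g := Subtype.ext (image_preimage_eq_of_subset
    (g.2.subset.trans (hf ▸ image_subset_range φ Q)))
  map_rel_iff' {a b} := image_subset_image_iff hφ

theorem exists_linearIsometry_range (W : Submodule ℝ (Eucl n)) (hW : Module.finrank ℝ W = m) :
    ∃ ι : Eucl m →ₗᵢ[ℝ] Eucl n, LinearMap.range ι.toLinearMap = W := by
  refine ⟨W.subtypeₗᵢ.comp
    ((stdOrthonormalBasis ℝ W).reindex (finCongr hW)).repr.symm.toLinearIsometry, ?_⟩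
  ext x
  constructor
  · rintro ⟨y, rfl⟩
    exact Subtype.mem _
  · intro hx
    exact ⟨((stdOrthonormalBasis ℝ W).reindex (finCongr hW)).repr ⟨x, hx⟩, by simp⟩

/-- An isometry that preserves the range of `ι` restricts along `ι`. -/
theorem exists_restrict_isometry (L : Eucl n ≃ₗᵢ[ℝ] Eucl n)
    (hL : ∀ x, ∃ y, ι y = L (ι x)) : ∃ T : Eucl m ≃ₗᵢ[ℝ] Eucl m, ∀ x, ι (T x) = L (ι x) := by
  obtain ⟨r, hr⟩ := LinearMap.exists_leftInverse_of_injective ι.toLinearMap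
    (LinearMap.ker_eq_bot.2 ι.injective)
  have hT : ∀ x, ι (r (L (ι x))) = L (ι x) := fun x => by
    obtain ⟨y, hy⟩ := hL x
    rw [← hy]
    exact congrArg ι (LinearMap.congr_fun hr y)
  let T : Eucl m →ₗᵢ[ℝ] Eucl m :=
    ⟨r ∘ₗ L.toLinearEquiv.toLinearMap ∘ₗ ι.toLinearMap, fun x => by
      rw [← ι.norm_map]
      show ‖ι (r (L (ι x)))‖ = ‖x‖
      rw [hT, L.norm_map, ι.norm_map]⟩
  exact ⟨T.toLinearIsometryEquiv rfl, hT⟩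

theorem IsFlag.exists_similarity_image (hP : IsPolytope P) (hF : IsFlag P F) (hm : m ≤ n)
    (hι : LinearMap.range ι.toLinearMap = vectorSpan ℝ (F m)) (hs : s ≠ 0) :
    similarityMap ι s (bary (F m)) '' (similarityMap ι s (bary (F m)) ⁻¹' F m) = F m := by
  apply image_preimage_eq_of_subset
  intro x hx
  have h : x - bary (F m) ∈ LinearMap.range ι.toLinearMap := by
    rw [hι]
    exact vsub_mem_vectorSpan ℝ hx (hF.bary_mem hP hm)
  obtain ⟨y, hy⟩ := h
  refine ⟨s⁻¹ • y, ?_⟩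
  rw [similarityMap_apply, map_smul, smul_smul, mul_inv_cancel₀ hs, one_smul]
  rw [LinearIsometry.coe_toLinearMap] at hy
  rw [hy]
  abel

theorem isPolytope_of_image {Q : Set (Eucl m)} {f : Set (Eucl n)} (φ : Eucl m →ᵃ[ℝ] Eucl n)
    (hφ : Function.Injective φ) (hf : φ '' Q = f) (hfin : IsFinHull f) (hne : f.Nonempty)
    (hd : Module.finrank ℝ (vectorSpan ℝ f) = m) : IsPolytope Q := by
  have hQne : Q.Nonempty := by rwa [← hf, image_nonempty] at hne
  obtain ⟨S, hS, hfS⟩ := hfin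
  refine ⟨⟨φ ⁻¹' S, hS.preimage hφ.injOn, ?_⟩, ?_⟩
  · apply hφ.image_injective
    rw [φ.image_convexHull, image_preimage_eq_of_subset, hf, hfS]
    exact (subset_convexHull ℝ S).trans (by rw [← hfS, ← hf]; exact image_subset_range φ Q)
  · rw [AffineSubspace.affineSpan_eq_top_iff_vectorSpan_eq_top_of_nonempty ℝ _ _ hQne]
    apply Submodule.eq_top_of_finrank_eq
    rw [← finrank_vectorSpan_image φ hφ, hf, hd]
    simp

/-- Two flags of the preimage extend by the upper part of `F` to flags of `P`. A symmetry of `P`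
relating them preserves `F m` and its barycenter, so its linear part restricts along `ι`. -/
theorem IsRegularEdgeScribed.isRegular_preimage (hP : IsRegularEdgeScribed P) (hF : IsFlag P F)
    (hm : m ≤ n) (hι : LinearMap.range ι.toLinearMap = vectorSpan ℝ (F m)) (hs : s ≠ 0) :
    IsRegular (similarityMap ι s (bary (F m)) ⁻¹' F m) := by
  have hPp := hP.isPolytope
  intro G H hG hH
  set φ := similarityMap ι s (bary (F m)) with hφdef
  have hφ : Function.Injective φ := similarityMap_injective hs
  have hQ := hF.exists_similarity_image hPp hm hι hs
  rw [← hφdef] at hQ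
  set e := imageFaceIso φ hφ _ hQ
  have hface : ∀ h, IsExposed ℝ (φ ⁻¹' F m) h → faceMap e h = φ '' h := fun h hh => by
    rw [faceMap_of_isExposed hh]; rfl
  have hG' : ∀ j ≤ m, flagMap e G j = φ '' G j := fun j hj => by
    rw [flagMap_of_le hj, hface _ (hG.isKFace hj).1]
  have hH' : ∀ j ≤ m, flagMap e H j = φ '' H j := fun j hj => by
    rw [flagMap_of_le hj, hface _ (hH.isKFace hj).1]
  obtain ⟨g, hg, hgF⟩ := hP.isRegular _ _ (hF.flagMap (e := e) hPp.isFinHull hm hG)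
    (hF.flagMap (e := e) hPp.isFinHull hm hH)
  have hgm : g '' F m = F m := by
    have := hgF m hm
    rwa [hG' m le_rfl, hH' m le_rfl, hG.2.2, hH.2.2, hQ] at this
  have hgb := hF.map_bary hPp hm hgm
  have hL : ∀ x, g x = g.linearIsometryEquiv (x - bary (F m)) + bary (F m) := fun x => by
    have := g.map_vsub x (bary (F m))
    rw [hgb, vsub_eq_sub, vsub_eq_sub] at this
    rw [this]; abel
  have hLW : ∀ w ∈ vectorSpan ℝ (F m), g.linearIsometryEquiv w ∈ vectorSpan ℝ (F m) := by
    intro w hw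
    rw [vectorSpan_def] at hw
    induction hw using Submodule.span_induction with
    | mem x hx =>
      obtain ⟨a, ha, b, hb, rfl⟩ := hx
      show g.linearIsometryEquiv (a -ᵥ b) ∈ _
      rw [g.map_vsub]
      exact vsub_mem_vectorSpan ℝ (hgm ▸ mem_image_of_mem g ha) (hgm ▸ mem_image_of_mem g hb)
    | zero => simp
    | add x y _ _ hx hy => rw [map_add]; exact Submodule.add_mem _ hx hy
    | smul a x _ hx => rw [map_smul]; exact Submodule.smul_mem _ _ hx
  obtain ⟨T, hT⟩ := exists_restrict_isometry (ι := ι) g.linearIsometryEquiv fun x => by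
    have h1 : ι x ∈ vectorSpan ℝ (F m) := hι ▸ LinearMap.mem_range_self ι.toLinearMap x
    have h2 := hLW _ h1
    rw [← hι] at h2
    exact h2
  have hcomm : ∀ x, φ (T.toAffineIsometryEquiv x) = g (φ x) := fun x => by
    show φ (T x) = _
    rw [hL, hφdef, similarityMap_apply, similarityMap_apply, hT, add_sub_cancel_right, map_smul]
  have himg : ∀ h, φ '' (T.toAffineIsometryEquiv '' h) = g '' (φ '' h) := fun h => by
    rw [image_image, image_image]
    exact image_congr fun x _ => hcomm x
  refine ⟨T.toAffineIsometryEquiv, hφ.image_injective ?_, fun j hj => hφ.image_injective ?_⟩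
  · show φ '' _ = φ '' _
    rw [himg, hQ, hgm]
  · show φ '' _ = φ '' _
    rw [himg, ← hG' j hj, hgF j (hj.trans hm), hH' j hj]

/-- A face of a regular edge-scribed polytope is similar to a regular edge-scribed polytope. -/
theorem IsRegularEdgeScribed.exists_realization (hP : IsRegularEdgeScribed P) (hF : IsFlag P F)
    (hm : 2 ≤ m) (hmn : m ≤ n) : ∃ Q : Set (Eucl m), IsRegularEdgeScribed Q ∧ CombEquiv Q (F m) ∧
      ∀ G, IsFlag Q G → ‖bary (F m)‖ < 1 ∧ ‖bary (G 1) - bary (G 0)‖ ^ 2 =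
        ‖bary (F 1) - bary (F 0)‖ ^ 2 / (1 - ‖bary (F m)‖ ^ 2) := by
  have hPp := hP.isPolytope
  have hn : 2 ≤ n := hm.trans hmn
  have hb1 : ‖bary (F m)‖ < 1 := by
    -- The norms of the barycenters decrease strictly from `‖bary (F 1)‖ = 1`.
    have h1 : ∀ k, 2 ≤ k → k ≤ n → ‖bary (F k)‖ ^ 2 < 1 := by
      intro k hk
      induction k, hk using Nat.le_induction with
      | base =>
        intro _
        have h := hP.norm_bary_sq_sub hn hF (i := 1) (by omega)
        have h' := hP.norm_step_sq_pos hF (i := 1) (by omega)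
        rw [(hP.norm_bary_zero_sq hF hn).2] at h
        linarith
      | succ k hk ih =>
        intro hk'
        have h := hP.norm_bary_sq_sub hn hF (i := k) hk'
        have h' := hP.norm_step_sq_pos hF (i := k) hk'
        have := ih (by omega)
        linarith
    have := h1 m hm hmn
    rwa [sq_lt_one_iff₀ (norm_nonneg _)] at this
  have hpos : 0 < 1 - ‖bary (F m)‖ ^ 2 := by
    have : ‖bary (F m)‖ ^ 2 < 1 := (sq_lt_one_iff₀ (norm_nonneg _)).2 hb1
    linarith
  -- The radius of the section of the unit sphere by the affine span of `F m`, so that `φ` maps the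
  -- unit sphere of `Eucl m` onto this section.
  obtain ⟨s, hs⟩ : ∃ s, s = √(1 - ‖bary (F m)‖ ^ 2) := ⟨_, rfl⟩
  have hs0 : 0 < s := hs ▸ Real.sqrt_pos.2 hpos
  have hs2 : s ^ 2 = 1 - ‖bary (F m)‖ ^ 2 := by rw [hs, Real.sq_sqrt hpos.le]
  obtain ⟨ι, hι⟩ := exists_linearIsometry_range _ (hF.isKFace hmn).2.2
  have hQ := hF.exists_similarity_image hPp hmn hι hs0.ne'
  have hreg := hP.isRegular_preimage hF hmn hι hs0.ne'
  set φ := similarityMap ι s (bary (F m)) with hφdef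
  have hφ : Function.Injective φ := similarityMap_injective hs0.ne'
  set Q := φ ⁻¹' F m with hQdef
  have hQp : IsPolytope Q := isPolytope_of_image φ hφ hQ (hF.isFinHull hPp.isFinHull hmn)
    (hF.nonempty hmn) (hF.isKFace hmn).2.2
  -- the center of `F m` is the projection of the origin to its affine span
  have hnorm : ∀ x, ‖φ x‖ ^ 2 = s ^ 2 * ‖x‖ ^ 2 + ‖bary (F m)‖ ^ 2 := by
    intro x
    have h0 : ∀ w ∈ vectorSpan ℝ (F m), ⟪bary (F m), w⟫ = 0 := by
      intro w hw
      rw [vectorSpan_def] at hw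
      induction hw using Submodule.span_induction with
      | mem x hx =>
        obtain ⟨a, ha, b, hb, rfl⟩ := hx
        have := hP.isRegular.inner_bary_sub hPp hF hmn le_rfl ha hb
        rw [hP.bary_last hF hn, zero_sub, inner_neg_left, neg_eq_zero] at this
        exact this
      | zero => simp
      | add x y _ _ hx hy => rw [inner_add_right, hx, hy, add_zero]
      | smul a x _ hx => rw [inner_smul_right, hx, mul_zero]
    have h1 : ι x ∈ vectorSpan ℝ (F m) := hι ▸ LinearMap.mem_range_self ι.toLinearMap x
    rw [hφdef, similarityMap_apply, norm_add_sq_real, real_inner_smul_left, real_inner_comm,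
      h0 _ h1, norm_smul, mul_pow, ι.norm_map, Real.norm_eq_abs, sq_abs]
    ring
  have hkface : ∀ k f, IsKFace Q k f → IsKFace P k (φ '' f) := fun k f hf => by
    have := (isKFace_image φ hφ).2 hf
    rw [hQ] at this
    exact (hF.isKFace hmn).trans hPp.isFinHull this
  have hscr : IsEdgeScribed Q := by
    intro e he
    obtain ⟨_, ⟨x, hx, rfl⟩, hx1, hmin⟩ := hP.isEdgeScribed _ (hkface 1 e he)
    refine ⟨x, hx, ?_, fun y hy => ?_⟩
    · have h := hnorm x
      rw [hx1, hs2] at h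
      have : ‖x‖ ^ 2 = 1 := by
        apply mul_left_cancel₀ hpos.ne'
        linarith
      exact (pow_eq_one_iff_of_nonneg (norm_nonneg _) two_ne_zero).1 this
    · have h1 : φ y ∈ affineSpan ℝ (φ '' e) := by
        rw [← AffineSubspace.map_span]
        exact ⟨y, hy, rfl⟩
      have h2 := hmin _ h1
      have h3 := hnorm y
      have h4 : 1 ≤ ‖φ y‖ ^ 2 := by nlinarith
      rw [h3, hs2] at h4
      have : 1 ≤ ‖y‖ ^ 2 := by
        by_contra! hlt
        nlinarith
      by_contra! hlt
      nlinarith [norm_nonneg y]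
  refine ⟨Q, ⟨hQp, hreg, hscr⟩, ⟨imageFaceIso φ hφ _ hQ⟩, fun G hG => ⟨hb1, ?_⟩⟩
  have hQr : IsRegularEdgeScribed Q := ⟨hQp, hreg, hscr⟩
  have hv := hG.bary_zero_mem_extremePoints hQp le_rfl
  rw [hG.2.2] at hv
  have h1 := hQr.norm_vertex_sq hG hm hv
  have h2 : φ (bary (G 0)) ∈ P.extremePoints ℝ := by
    apply (hF.isKFace hmn).1.isExtreme.extremePoints_subset_extremePoints
    rw [← hQ, extremePoints_affineMap_image φ hφ]
    exact mem_image_of_mem φ hv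
  have h3 := hP.norm_vertex_sq hF hn h2
  rw [hnorm, h1, hs2] at h3
  rw [eq_div_iff hpos.ne']
  linarith

end Realization

/-! ### Lorentzian curvatures and the numbers L in terms of barycenters. -/

section Curvature

variable {d : ℕ} {P f : Set (Eucl (d + 1))} {F : ℕ → Set (Eucl (d + 1))} {i : ℕ}

theorem curv_eq (x : Lor d) : curv x = x (Fin.last (d + 1)) - x (Fin.last d).castSucc := by
  have h1 : northVec d (Fin.last (d + 1)) = 1 := by
    simp [northVec, Fin.ext_iff]
  have h2 : ∀ j : Fin (d + 1), northVec d j.castSucc = if j = Fin.last d then 1 else 0 := by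
    intro j
    have : j.castSucc ≠ Fin.last (d + 1) := (Fin.castSucc_lt_last j).ne
    simp [northVec, Pi.single_apply, Fin.castSucc_inj, this]
  rw [curv, lorentzProd, h1]
  simp [h2]

theorem curv_ballVec (v : Eucl (d + 1)) :
    curv (ballVec v) = (√(‖v‖ ^ 2 - 1))⁻¹ * (1 - v (Fin.last d)) := by
  rw [curv_eq, ballVec, Pi.smul_apply, Pi.smul_apply, Fin.snoc_last, Fin.snoc_castSucc, smul_eq_mul,
    smul_eq_mul]
  ring

/-- The curvature of a polytope whose vertices lie on a sphere centred at the origin. -/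
theorem lorentzCurv_eq (hf : IsFinHull f) (hne : f.Nonempty) {l : ℝ} (hl : 0 ≤ l)
    (hv : ∀ v ∈ f.extremePoints ℝ, ‖v‖ ^ 2 = 1 + l ^ 2) :
    lorentzCurv f = l⁻¹ * (1 - bary f (Fin.last d)) := by
  have hc := hf.card_extremePoints_pos hne
  have hncard : (f.extremePoints ℝ).ncard = hf.finite_extremePoints.toFinset.card :=
    Set.ncard_eq_toFinset_card _ hf.finite_extremePoints
  have hsum : ∑ v ∈ hf.finite_extremePoints.toFinset, curv (ballVec v) =
      ∑ v ∈ hf.finite_extremePoints.toFinset, l⁻¹ * (1 - v (Fin.last d)) := by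
    refine Finset.sum_congr rfl fun v hv' => ?_
    rw [curv_ballVec, hv v (by simpa using hv'), add_sub_cancel_left, Real.sqrt_sq hl]
  have hlin : lorentzCurv f = (hf.finite_extremePoints.toFinset.card : ℝ)⁻¹ *
      ∑ v ∈ hf.finite_extremePoints.toFinset, curv (ballVec v) := by
    rw [lorentzCurv, lorentzBary, hncard,
      finsum_mem_eq_finite_toFinset_sum _ hf.finite_extremePoints, curv_eq, Pi.smul_apply,
      Pi.smul_apply, Finset.sum_apply, Finset.sum_apply, smul_eq_mul, smul_eq_mul, ← mul_sub,
      ← Finset.sum_sub_distrib]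
    congr 1
    exact Finset.sum_congr rfl fun v _ => (curv_eq _).symm
  have hbary : bary f (Fin.last d) = (hf.finite_extremePoints.toFinset.card : ℝ)⁻¹ *
      ∑ v ∈ hf.finite_extremePoints.toFinset, v (Fin.last d) := by
    rw [hf.bary_eq_sum]
    simp
  rw [hlin, hsum, hbary, ← Finset.mul_sum, Finset.sum_sub_distrib, Finset.sum_const, nsmul_eq_mul,
    mul_one]
  field_simp

theorem IsRegularEdgeScribed.lorentzCurv_flag (hP : IsRegularEdgeScribed P) (hd : 1 ≤ d)
    (hF : IsFlag P F) (hi : i ≤ d + 1) :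
    lorentzCurv (F i) = ‖bary (F 1) - bary (F 0)‖⁻¹ * (1 - bary (F i) (Fin.last d)) :=
  lorentzCurv_eq (hF.isFinHull hP.isPolytope.isFinHull hi) (hF.nonempty hi) (norm_nonneg _)
    fun v hv => hP.norm_vertex_sq hF (by omega)
      ((hF.isKFace hi).1.isExtreme.extremePoints_subset_extremePoints hv)

/-- If `ℓ i` is the half edge-length of the regular edge-scribed realization of `F i`, the
number `L(i)` is the power of the barycenter of `F i` with respect to the unit sphere, up to sign
and the scaling factor `‖b 1 - b 0‖ ^ 2`. -/
theorem IsRegularEdgeScribed.levelL_eq (hP : IsRegularEdgeScribed P) (hd : 1 ≤ d)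
    (hF : IsFlag P F) {ℓ : ℕ → ℝ} (hℓ : ∀ i, 2 ≤ i → i ≤ d + 1 →
      ℓ i ^ 2 = ‖bary (F 1) - bary (F 0)‖ ^ 2 / (1 - ‖bary (F i)‖ ^ 2)) (hi : i ≤ d + 1) :
    levelL ℓ i = (1 - ‖bary (F i)‖ ^ 2) / ‖bary (F 1) - bary (F 0)‖ ^ 2 := by
  have hl := hP.norm_step_sq_pos hF (i := 0) (by omega)
  rw [zero_add] at hl
  obtain ⟨h0, h1⟩ := hP.norm_bary_zero_sq hF (by omega)
  match i, hi with
  | 0, _ =>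
    rw [levelL, h0, sub_add_cancel_left, neg_div, div_self hl.ne']
  | 1, _ =>
    rw [levelL, h1]
    norm_num
  | i + 2, hi =>
    rw [levelL, hℓ _ (by omega) hi, inv_div]

end Curvature

end PolytopalDescartes

/-! ### The main theorem. -/

theorem theorem4p1 (d : ℕ) (hd : 1 ≤ d) (P : Set (Eucl (d + 1))) (hP : IsRegularEdgeScribed P)
    (p : ℕ → ℕ) (hp : HasSchlafliSymbol P p) (F : ℕ → Set (Eucl (d + 1))) (hF : IsFlag P F) :
    ∃ ℓ : ℕ → ℝ,
      -- `ℓ i` is the half edge-length of a regular edge-scribed realization of `F i`; such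
      -- realizations exist, and `ℓ i` depends only on the symbol `{p 1, …, p (i - 1)}`
      (∀ i, 2 ≤ i → i ≤ d + 1 →
        0 < ℓ i ∧
        (∃ Q : Set (Eucl i),
          IsRegularEdgeScribed Q ∧ HasSchlafliSymbol Q p ∧ CombEquiv Q (F i)) ∧
        (∀ Q : Set (Eucl i), IsRegularEdgeScribed Q →
          HasSchlafliSymbol Q p ∨ CombEquiv Q (F i) → HasHalfEdgeLength Q (ℓ i))) ∧
      -- the denominators below are positive
      (∀ i ≤ d, levelL ℓ i < levelL ℓ (i + 1)) ∧
      lorentzCurv P ^ 2 =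
        levelL ℓ (d + 1) * ∑ i ∈ Finset.range (d + 1),
          (lorentzCurv (F i) - lorentzCurv (F (i + 1))) ^ 2 /
            (levelL ℓ (i + 1) - levelL ℓ i) := by
  have hn : 2 ≤ d + 1 := by omega
  have hl := hP.norm_step_sq_pos hF (i := 0) (by omega)
  rw [zero_add] at hl
  have hl0 : 0 < ‖bary (F 1) - bary (F 0)‖ :=
    norm_pos_iff.2 (hF.bary_ne hP.isPolytope (k := 0) (by omega))
  have hbi : ∀ i, 2 ≤ i → i ≤ d + 1 → 0 < 1 - ‖bary (F i)‖ ^ 2 := by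
    intro i h2 hi
    obtain ⟨Q, hQ, -, hQl⟩ := hP.exists_realization hF h2 hi
    obtain ⟨G, hG⟩ := hQ.isPolytope.exists_flag
    have := (sq_lt_one_iff₀ (norm_nonneg _)).2 (hQl G hG).1
    linarith
  have hℓ : ∀ i, 2 ≤ i → i ≤ d + 1 →
      (‖bary (F 1) - bary (F 0)‖ / √(1 - ‖bary (F i)‖ ^ 2)) ^ 2 =
        ‖bary (F 1) - bary (F 0)‖ ^ 2 / (1 - ‖bary (F i)‖ ^ 2) := by
    intro i h2 hi
    rw [div_pow, Real.sq_sqrt (hbi i h2 hi).le]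
  -- The half edge-length of `F i` after rescaling. For `i < 2` the square root is `0` and the value
  -- is junk, but `levelL` does not read it there.
  refine ⟨fun i => ‖bary (F 1) - bary (F 0)‖ / √(1 - ‖bary (F i)‖ ^ 2), ?_, ?_, ?_⟩
  · intro i h2 hi
    have hpos : 0 < ‖bary (F 1) - bary (F 0)‖ / √(1 - ‖bary (F i)‖ ^ 2) :=
      div_pos hl0 (Real.sqrt_pos.2 (hbi i h2 hi))
    obtain ⟨Q, hQ, hQF, hQl⟩ := hP.exists_realization hF h2 hi
    have hQp := hP.hasSchlafliSymbol_of_combEquiv hi h2 hF hQ hp hQF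
    refine ⟨hpos, ⟨Q, hQ, hQp, hQF⟩, fun R hR hRpF => ?_⟩
    -- Both alternatives reduce to the symbol, which `R` then shares with the explicit realization
    -- `Q`.
    have hRp : HasSchlafliSymbol R p :=
      hRpF.elim id (hP.hasSchlafliSymbol_of_combEquiv hi h2 hF hR hp)
    obtain ⟨G, hG⟩ := hQ.isPolytope.exists_flag
    obtain ⟨H, hH⟩ := hR.isPolytope.exists_flag
    have h := hR.hasHalfEdgeLength hH (by omega)
    rw [hR.norm_edge_eq_of_symbol hQ h2 hRp hQp hH hG] at h
    have he : ‖bary (G 1) - bary (G 0)‖ = ‖bary (F 1) - bary (F 0)‖ / √(1 - ‖bary (F i)‖ ^ 2) := by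
      apply (pow_left_inj₀ (norm_nonneg _) hpos.le two_ne_zero).1
      rw [(hQl G hG).2, hℓ i h2 hi]
    rwa [he] at h
  · intro i hi
    rw [hP.levelL_eq hd hF hℓ (by omega), hP.levelL_eq hd hF hℓ (by omega)]
    have h1 := hP.norm_bary_sq_sub hn hF (i := i) (by omega)
    have h2 := hP.norm_step_sq_pos hF (i := i) (by omega)
    apply div_lt_div_of_pos_right _ hl
    linarith
  · have hlast : bary (F (d + 1)) = 0 := hP.bary_last hF hn
    have hκ := hP.lorentzCurv_flag hd hF le_rfl
    rw [hF.2.2] at hκ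
    rw [hP.bary_self hn] at hκ
    rw [hκ, hP.levelL_eq hd hF hℓ le_rfl, hlast]
    -- The differences of curvatures are, up to the common factor `‖bary (F 1) - bary (F 0)‖⁻¹`, the
    -- last coordinates of the steps; this factor cancels in each quotient, leaving Parseval for the
    -- last unit vector.
    have hone := sum_inner_sq_div_eq (d := fun i => bary (F (i + 1)) - bary (F i))
      (fun i hi => hF.bary_ne hP.isPolytope hi)
      (hP.isRegular.inner_bary_diff hP.isPolytope hF) (EuclideanSpace.single (Fin.last d) (1 : ℝ))
    rw [PiLp.norm_single, norm_one, one_pow] at hone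
    have hterm : ∑ i ∈ Finset.range (d + 1), (lorentzCurv (F i) - lorentzCurv (F (i + 1))) ^ 2 /
        (levelL (fun i => ‖bary (F 1) - bary (F 0)‖ / √(1 - ‖bary (F i)‖ ^ 2)) (i + 1) -
          levelL (fun i => ‖bary (F 1) - bary (F 0)‖ / √(1 - ‖bary (F i)‖ ^ 2)) i) = 1 := by
      refine (Finset.sum_congr rfl fun i hi => ?_).trans hone
      have hi' := Finset.mem_range.1 hi
      rw [hP.levelL_eq hd hF hℓ hi'.le, hP.levelL_eq hd hF hℓ hi', hP.lorentzCurv_flag hd hF hi'.le,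
        hP.lorentzCurv_flag hd hF hi', EuclideanSpace.inner_single_right, ← sub_div,
        sub_sub_sub_cancel_left, hP.norm_bary_sq_sub hn hF hi']
      have hpos := hP.norm_step_sq_pos hF hi'
      simp only [PiLp.sub_apply, conj_trivial]
      field_simp
      ring
    rw [hterm]
    simp
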